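/- For a $C^*$-algebra $A$ (not necessarily unital or separable) let $A_\infty=\ell^\infty(\mathbb N,A)/c_0(\mathbb N,A)$ be its sequence algebra, and view $A$ inside $A_\infty$ as the (classes of) constant sequences. A $*$-homomorphism $\varphi\colon A\to B$ between $C^*$-algebras is called *sequentially split* if there is a $*$-homomorphism $\psi\colon B\to A_\infty$ such that $\psi\circ\varphi$ is the canonical inclusion $A\to A_\infty$. Ideals are closed and two-sided, $\overline{\varphi(E)B\varphi(E)}$ and $\overline{B\varphi(J)B}$ denote closed linear spans, $\otimes_{\max}$ is the maximal tensor product, and $\mathcal K$ denotes the compact operators on $\ell^2(\mathbb N)$. $\mathrm{Cu}(A)$ is the Cuntz semigroup: classes $\langle a\rangle_A$ of positive elements $a\in A\otimes\mathcal K$, where $\langle a\rangle_A\le\langle b\rangle_A$ if there are $v_n\in A\otimes\mathcal K$ with $v_nbv_n^*\to a$. $K$-theory with coefficients is $K_*(A;\mathbb Z_n)=K_*(A\otimes C_0(W_n))$, where $W_n$ is the Moore space obtained by attaching a disk to the circle along a map of degree $n$, with its base point removed. $T(A)$ is the set of tracial states of $A$. **Theorem.** Let $A$ and $B$ be $C^*$-algebras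 and let $\varphi\colon A\to B$ be a sequentially split $*$-homomorphism. Then: 1. For each hereditary $C^*$-subalgebra $E\subseteq A$, the restriction $\varphi|_E\colon E\to\overline{\varphi(E)B\varphi(E)}$ is sequentially split. 2. For each ideal $J$ of $A$, the restriction $\varphi|_J\colon J\to\overline{B\varphi(J)B}$ and the induced map $A/J\to B/\overline{B\varphi(J)B}$ are sequentially split. 3. The map $J\mapsto\overline{B\varphi(J)B}$ from the ideals of $A$ to the ideals of $B$ is injective. 4. If $\rho\colon C\to D$ is another sequentially split $*$-homomorphism between $C^*$-algebras, then $\varphi\otimes\rho\colon A\otimes_{\max}C\to B\otimes_{\max}D$ is sequentially split. 5. The induced map $\mathrm{Cu}(A)\to\mathrm{Cu}(B)$, $\langle a\rangle_A\mapsto\langle(\varphi\otimes\mathrm{id}_{\mathcal K})(a)\rangle_B$, is an order embedding: $x\le y$ in $\mathrm{Cu}(A)$ if and only if the image of $x$ is $\le$ the image of $y$ in $\mathrm{Cu}(B)$. 6. $K_0(\varphi)\colon K_0(A)\to K_0(B)$ and $K_1(\varphi)\colon K_1(A)\to K_1(B)$ are injective, and so are the induced maps $K_0(A;\mathbb Z_n)\to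 K_0(B;\mathbb Z_n)$ and $K_1(A;\mathbb Z_n)\to K_1(B;\mathbb Z_n)$ for all $n\ge2$. 7. Every tracial state on $A$ is of the form $\tau\circ\varphi$ for some tracial state $\tau$ on $B$. (In particular, whenever $\tau\mapsto\tau\circ\varphi$ maps $T(B)$ into $T(A)$, for instance if $\varphi$ is non-degenerate, the induced map $T(B)\to T(A)$ is surjective.) -/

import Mathlib

universe u v w x

noncomputable section

open Filter Topology
open scoped ENNReal TensorProduct


/-! ### Closed ideals and quotients of C⋆-algebras -/

/-- A closed two-sided ideal of a C⋆-algebra. -/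
structure ClosedIdeal (A : Type u) [NonUnitalCStarAlgebra A] extends Submodule ℂ A where
  mul_mem_left' : ∀ (a : A) {j : A}, j ∈ carrier → a * j ∈ carrier
  mul_mem_right' : ∀ {j : A} (a : A), j ∈ carrier → j * a ∈ carrier
  isClosed' : IsClosed carrier

section approx

/-- Approximate units of a closed `*`-subalgebra. -/
theorem exists_approx_unit {A : Type u} [NonUnitalCStarAlgebra A]
    (S : NonUnitalStarSubalgebra ℂ A) (hS : IsClosed (S : Set A)) :
    ∃ l : Filter S, l.NeBot ∧ (∀ m : S, Tendsto (fun e : S => e * m) l (𝓝 m)) ∧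
      (∀ m : S, Tendsto (fun e : S => m * e) l (𝓝 m)) ∧
      (∀ᶠ e : S in l, star e = e) ∧ (∀ᶠ e : S in l, ‖(e : A)‖ ≤ 1) ∧
      ∀ᶠ e : S in l, ∀ z : A, ‖z - (e : A) * z‖ ≤ ‖z‖ := by
  have := hS
  let _ : PartialOrder S := CStarAlgebra.spectralOrder S
  have : StarOrderedRing S := CStarAlgebra.spectralOrderedRing S
  let _ : PartialOrder A := CStarAlgebra.spectralOrder A
  have : StarOrderedRing A := CStarAlgebra.spectralOrderedRing A
  have h := CStarAlgebra.increasingApproximateUnit S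
  refine ⟨CStarAlgebra.approximateUnit S, h.neBot, h.tendsto_mul_right, h.tendsto_mul_left,
    h.eventually_star_eq, h.eventually_norm, ?_⟩
  filter_upwards [h.eventually_nonneg, h.eventually_norm] with e he hn z
  have he' : (0 : A) ≤ (e : A) := by
    obtain ⟨s, hs⟩ := CStarAlgebra.nonneg_iff_eq_star_mul_self.1 he
    have : (e : A) = star (s : A) * (s : A) := congrArg Subtype.val hs
    rw [this]
    exact star_mul_self_nonneg _
  refine CStarAlgebra.norm_sub_mul_self_le_of_inr z le_rfl he' hn (norm_nonneg z) ?_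
  rw [Unitization.inr_zero, sub_zero, mul_one, CStarRing.norm_star_mul_self,
    Unitization.norm_inr, sq]

end approx

namespace ClosedIdeal

variable {A : Type u} [NonUnitalCStarAlgebra A]

instance : SetLike (ClosedIdeal A) A where
  coe J := J.carrier
  coe_injective J K h := by
    cases J with | mk J _ _ _ => cases K with | mk K _ _ _ =>
    have : J = K := SetLike.coe_injective h
    subst this; rfl

theorem mem_toSubmodule {J : ClosedIdeal A} {a : A} : a ∈ J.toSubmodule ↔ a ∈ J := Iff.rfl

theorem mul_mem_left (J : ClosedIdeal A) (a : A) {j : A} (hj : j ∈ J) : a * j ∈ J :=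
  J.mul_mem_left' a hj

theorem mul_mem_right (J : ClosedIdeal A) {j : A} (a : A) (hj : j ∈ J) : j * a ∈ J :=
  J.mul_mem_right' a hj

instance : NonUnitalSubringClass (ClosedIdeal A) A where
  add_mem {J} _ _ := J.toSubmodule.add_mem
  zero_mem J := J.toSubmodule.zero_mem
  neg_mem {J} _ := J.toSubmodule.neg_mem
  mul_mem {J} a _ _ hb := J.mul_mem_left a hb

instance : SMulMemClass (ClosedIdeal A) ℂ A where
  smul_mem {J} c _ h := J.toSubmodule.smul_mem c h

instance isClosed (J : ClosedIdeal A) : IsClosed (J : Set A) := J.isClosed'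

instance isClosed_toSubmodule (J : ClosedIdeal A) : IsClosed (J.toSubmodule : Set A) := J.isClosed'

/-- The self-adjoint part `J ∩ J⋆`; it is all of `J` by `ClosedIdeal.star_mem`. -/
def symm (J : ClosedIdeal A) : NonUnitalStarSubalgebra ℂ A where
  carrier := {a | a ∈ J ∧ star a ∈ J}
  add_mem' ha hb := ⟨add_mem ha.1 hb.1, by rw [star_add]; exact add_mem ha.2 hb.2⟩
  zero_mem' := ⟨zero_mem J, by rw [star_zero]; exact zero_mem J⟩
  mul_mem' ha hb := ⟨mul_mem ha.1 hb.1, by rw [star_mul]; exact mul_mem hb.2 ha.2⟩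
  smul_mem' c _ ha := ⟨SMulMemClass.smul_mem c ha.1, by
    rw [star_smul]; exact SMulMemClass.smul_mem _ ha.2⟩
  star_mem' ha := ⟨ha.2, by rw [star_star]; exact ha.1⟩

theorem isClosed_symm (J : ClosedIdeal A) : IsClosed (J.symm : Set A) :=
  J.isClosed.inter (J.isClosed.preimage continuous_star)

/-- Closed two-sided ideals of C⋆-algebras are self-adjoint. -/
theorem star_mem (J : ClosedIdeal A) {a : A} (ha : a ∈ J) : star a ∈ J := by
  obtain ⟨l, hl, h1, h2, hs, hn, hz⟩ := exists_approx_unit J.symm J.isClosed_symm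
  have hm : star a * a ∈ J.symm :=
    ⟨J.mul_mem_left _ ha, by rw [star_mul, star_star]; exact J.mul_mem_left _ ha⟩
  have key : Tendsto (fun e : J.symm => (e : A) * star a) l (𝓝 (star a)) := by
    rw [tendsto_iff_norm_sub_tendsto_zero]
    have h3 : Tendsto (fun e : J.symm => ‖(e : A) * (star a * a) - star a * a‖) l (𝓝 0) := by
      have := (continuous_subtype_val.tendsto _).comp (h1 ⟨star a * a, hm⟩)
      exact tendsto_iff_norm_sub_tendsto_zero.1 this
    have h4 : Tendsto (fun e : J.symm => Real.sqrt (2 * ‖(e : A) * (star a * a) - star a * a‖)) l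
        (𝓝 0) := by
      have := (Real.continuous_sqrt.tendsto _).comp (h3.const_mul 2)
      rw [mul_zero, Real.sqrt_zero] at this
      exact this
    refine squeeze_zero' (Eventually.of_forall fun _ => norm_nonneg _) ?_ h4
    filter_upwards [hs, hn] with e hse hne
    have hse' : star (e : A) = e := congrArg Subtype.val hse
    apply Real.le_sqrt_of_sq_le
    have e1 : ((e : A) * star a - star a) * star ((e : A) * star a - star a) =
        ((e : A) * (star a * a) - star a * a) * (e : A) -
          ((e : A) * (star a * a) - star a * a) := by
      simp only [star_sub, star_mul, star_star, hse', mul_sub, sub_mul, mul_assoc]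
    rw [sq, ← CStarRing.norm_self_mul_star, e1]
    refine (norm_sub_le _ _).trans ?_
    have := norm_mul_le ((e : A) * (star a * a) - star a * a) (e : A)
    nlinarith [norm_nonneg ((e : A) * (star a * a) - star a * a)]
  exact J.isClosed.mem_of_tendsto key
    (Eventually.of_forall fun e => J.mul_mem_right _ e.2.1)

instance : StarMemClass (ClosedIdeal A) A where
  star_mem {J} _ h := J.star_mem h

/-- The quotient `A / J`, with the quotient norm. -/
def Quotient (J : ClosedIdeal A) : Type u := A ⧸ J.toSubmodule

namespace Quotient

variable (J : ClosedIdeal A)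

instance : NormedAddCommGroup J.Quotient :=
  inferInstanceAs (NormedAddCommGroup (A ⧸ J.toSubmodule))

instance : NormedSpace ℂ J.Quotient := inferInstanceAs (NormedSpace ℂ (A ⧸ J.toSubmodule))

instance : CompleteSpace J.Quotient := inferInstanceAs (CompleteSpace (A ⧸ J.toSubmodule))

/-- The class of an element. -/
def of (a : A) : J.Quotient := Submodule.Quotient.mk (p := J.toSubmodule) a

theorem of_surjective : Function.Surjective (of J) :=
  Submodule.Quotient.mk_surjective J.toSubmodule

theorem of_eq {a b : A} : of J a = of J b ↔ a - b ∈ J :=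
  Submodule.Quotient.eq J.toSubmodule

theorem of_add (a b : A) : of J (a + b) = of J a + of J b := rfl

theorem of_zero : of J 0 = 0 := rfl

theorem of_smul (c : ℂ) (a : A) : of J (c • a) = c • of J a := rfl

theorem of_neg (a : A) : of J (-a) = - of J a := rfl

theorem of_sub (a b : A) : of J (a - b) = of J a - of J b := rfl

theorem norm_of_le (a : A) : ‖of J a‖ ≤ ‖a‖ := Submodule.Quotient.norm_mk_le J.toSubmodule a

theorem exists_norm_lt (q : J.Quotient) {ε : ℝ} (hε : 0 < ε) :
    ∃ a : A, of J a = q ∧ ‖a‖ < ‖q‖ + ε :=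
  Submodule.Quotient.norm_mk_lt (S := J.toSubmodule) q hε

instance : Mul J.Quotient where
  mul := Quotient.map₂ (fun a b => a * b) (by
    intro a a' ha b b' hb
    rw [← Quotient.eq_iff_equiv] at ha hb ⊢
    have ha' : a - a' ∈ J := (of_eq J).1 ha
    have hb' : b - b' ∈ J := (of_eq J).1 hb
    refine (of_eq J).2 ?_
    have : a * b - a' * b' = a * (b - b') + (a - a') * b' := by
      simp only [mul_sub, sub_mul]; abel
    rw [this]
    exact add_mem (J.mul_mem_left _ hb') (J.mul_mem_right _ ha'))

theorem of_mul (a b : A) : of J (a * b) = of J a * of J b := rfl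

instance : Star J.Quotient where
  star := Quotient.map (fun a => star a) (by
    intro a a' ha
    rw [← Quotient.eq_iff_equiv] at ha ⊢
    have ha' : a - a' ∈ J := (of_eq J).1 ha
    refine (of_eq J).2 ?_
    rw [← star_sub]
    exact J.star_mem ha')

theorem of_star (a : A) : of J (star a) = star (of J a) := rfl

instance : NonUnitalNormedRing J.Quotient :=
  { (inferInstance : NormedAddCommGroup J.Quotient) with
    mul := (· * ·)
    left_distrib := by
      intro a b c
      obtain ⟨a, rfl⟩ := of_surjective J a
      obtain ⟨b, rfl⟩ := of_surjective J b
      obtain ⟨c, rfl⟩ := of_surjective J c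
      simp only [← of_mul, ← of_add, mul_add]
    right_distrib := by
      intro a b c
      obtain ⟨a, rfl⟩ := of_surjective J a
      obtain ⟨b, rfl⟩ := of_surjective J b
      obtain ⟨c, rfl⟩ := of_surjective J c
      simp only [← of_mul, ← of_add, add_mul]
    zero_mul := by
      intro a
      obtain ⟨a, rfl⟩ := of_surjective J a
      rw [← of_zero, ← of_mul, zero_mul]
    mul_zero := by
      intro a
      obtain ⟨a, rfl⟩ := of_surjective J a
      rw [← of_zero, ← of_mul, mul_zero]
    mul_assoc := by
      intro a b c
      obtain ⟨a, rfl⟩ := of_surjective J a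
      obtain ⟨b, rfl⟩ := of_surjective J b
      obtain ⟨c, rfl⟩ := of_surjective J c
      simp only [← of_mul, mul_assoc]
    norm_mul_le := by
      intro p q
      have h : ∀ ε : ℝ, 0 < ε → ‖p * q‖ ≤ (‖p‖ + ε) * (‖q‖ + ε) := by
        intro ε hε
        obtain ⟨a, rfl, ha⟩ := exists_norm_lt J p hε
        obtain ⟨b, rfl, hb⟩ := exists_norm_lt J q hε
        rw [← of_mul]
        refine (norm_of_le J _).trans ((norm_mul_le _ _).trans ?_)
        gcongr
      have hc : Tendsto (fun ε : ℝ => (‖p‖ + ε) * (‖q‖ + ε)) (𝓝[>] 0)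
          (𝓝 ((‖p‖ + 0) * (‖q‖ + 0))) :=
        (Continuous.tendsto (by fun_prop) 0).mono_left nhdsWithin_le_nhds
      simp only [add_zero] at hc
      exact ge_of_tendsto hc (eventually_nhdsWithin_of_forall fun ε hε => h ε hε) }

instance : StarRing J.Quotient where
  star_involutive a := by
    obtain ⟨a, rfl⟩ := of_surjective J a
    rw [← of_star, ← of_star, star_star]
  star_mul a b := by
    obtain ⟨a, rfl⟩ := of_surjective J a
    obtain ⟨b, rfl⟩ := of_surjective J b
    simp only [← of_star, ← of_mul, star_mul]
  star_add a b := by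
    obtain ⟨a, rfl⟩ := of_surjective J a
    obtain ⟨b, rfl⟩ := of_surjective J b
    simp only [← of_star, ← of_add, star_add]

instance : CStarRing J.Quotient where
  norm_mul_self_le q := by
    obtain ⟨a, rfl⟩ := of_surjective J q
    obtain ⟨l, hl, h1, h2, hs, hn, hz⟩ := exists_approx_unit J.symm J.isClosed_symm
    rw [← of_star, ← of_mul]
    refine le_of_forall_pos_le_add fun ε hε => ?_
    obtain ⟨b, hb, hbn⟩ := exists_norm_lt J (of J (star a * a)) hε
    have hj : star a * a - b ∈ J := (of_eq J).1 hb.symm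
    have hj' : star a * a - b ∈ J.symm := ⟨hj, J.star_mem hj⟩
    have h3 : Tendsto (fun e : J.symm => ‖b‖ + ‖(e : A) * (star a * a - b) - (star a * a - b)‖) l
        (𝓝 (‖b‖ + 0)) := by
      have := (continuous_subtype_val.tendsto _).comp (h1 ⟨star a * a - b, hj'⟩)
      exact (tendsto_iff_norm_sub_tendsto_zero.1 this).const_add _
    rw [add_zero] at h3
    refine le_trans (ge_of_tendsto h3 ?_) hbn.le
    filter_upwards [hs, hz] with e hse hze
    have hse' : star (e : A) = e := congrArg Subtype.val hse
    have hze' : ∀ z : A, ‖z - z * (e : A)‖ ≤ ‖z‖ := fun z => by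
      have := hze (star z)
      rwa [norm_star, ← norm_star, star_sub, star_mul, star_star, hse'] at this
    have hae : of J a = of J (a - a * (e : A)) :=
      (of_eq J).2 (by rw [sub_sub_cancel]; exact J.mul_mem_left _ e.2.1)
    rw [hae]
    have hsplit : star (a - a * (e : A)) * (a - a * (e : A)) =
        ((b - (e : A) * b) - (b - (e : A) * b) * (e : A)) +
        (((star a * a - b) - (e : A) * (star a * a - b)) -
          ((star a * a - b) - (e : A) * (star a * a - b)) * (e : A)) := by
      simp only [star_sub, star_mul, hse', mul_sub, sub_mul, mul_assoc]
      abel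
    calc ‖of J (a - a * (e : A))‖ * ‖of J (a - a * (e : A))‖
        ≤ ‖a - a * (e : A)‖ * ‖a - a * (e : A)‖ := by
          gcongr <;> exact norm_of_le J _
      _ = ‖star (a - a * (e : A)) * (a - a * (e : A))‖ := (CStarRing.norm_star_mul_self).symm
      _ ≤ _ := by
          rw [hsplit]
          refine (norm_add_le _ _).trans (add_le_add ((hze' _).trans (hze _)) ?_)
          rw [norm_sub_rev ((e : A) * _)]
          exact hze' _

instance : NonUnitalCStarAlgebra J.Quotient where
  smul_assoc c a b := by
    obtain ⟨a, rfl⟩ := of_surjective J a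
    obtain ⟨b, rfl⟩ := of_surjective J b
    simp only [smul_eq_mul, ← of_mul, ← of_smul, smul_mul_assoc]
  smul_comm c a b := by
    obtain ⟨a, rfl⟩ := of_surjective J a
    obtain ⟨b, rfl⟩ := of_surjective J b
    simp only [smul_eq_mul, ← of_mul, ← of_smul, mul_smul_comm]
  star_smul c a := by
    obtain ⟨a, rfl⟩ := of_surjective J a
    simp only [← of_star, ← of_smul, star_smul]

/-- The quotient map `A → A / J`. -/
def mk : A →⋆ₙₐ[ℂ] J.Quotient where
  toFun := of J
  map_smul' _ _ := rfl
  map_zero' := rfl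
  map_add' _ _ := rfl
  map_mul' _ _ := rfl
  map_star' _ := rfl

end Quotient
end ClosedIdeal

namespace ClosedIdeal

variable {A : Type u} {B : Type v} [NonUnitalCStarAlgebra A] [NonUnitalCStarAlgebra B]

/-- The map `A / J → B / K` induced by a `*`-homomorphism `φ` with `φ(J) ⊆ K`. -/
def Quotient.map (φ : A →⋆ₙₐ[ℂ] B) (J : ClosedIdeal A) (K : ClosedIdeal B)
    (h : ∀ a ∈ J, φ a ∈ K) : J.Quotient →⋆ₙₐ[ℂ] K.Quotient where
  toFun := _root_.Quotient.map (fun a => φ a) (by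
    intro a a' ha
    rw [← Quotient.eq_iff_equiv] at ha ⊢
    have ha' : a - a' ∈ J := (Quotient.of_eq J).1 ha
    refine (Quotient.of_eq K).2 ?_
    rw [← map_sub]
    exact h _ ha')
  map_smul' c q := by
    obtain ⟨a, rfl⟩ := Quotient.of_surjective J q
    exact congrArg (Quotient.of K) (map_smul φ c a)
  map_zero' := congrArg (Quotient.of K) (map_zero φ)
  map_add' p q := by
    obtain ⟨a, rfl⟩ := Quotient.of_surjective J p
    obtain ⟨b, rfl⟩ := Quotient.of_surjective J q
    exact congrArg (Quotient.of K) (map_add φ a b)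
  map_mul' p q := by
    obtain ⟨a, rfl⟩ := Quotient.of_surjective J p
    obtain ⟨b, rfl⟩ := Quotient.of_surjective J q
    exact congrArg (Quotient.of K) (map_mul φ a b)
  map_star' q := by
    obtain ⟨a, rfl⟩ := Quotient.of_surjective J q
    exact congrArg (Quotient.of K) (map_star φ a)

theorem Quotient.map_mk (φ : A →⋆ₙₐ[ℂ] B) (J : ClosedIdeal A) (K : ClosedIdeal B)
    (h : ∀ a ∈ J, φ a ∈ K) (a : A) :
    Quotient.map φ J K h (Quotient.mk J a) = Quotient.mk K (φ a) := rfl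

/-- The closed ideal generated by `φ(J)`, i.e. the closed linear span of `B φ(J) B`. -/
def map (φ : A →⋆ₙₐ[ℂ] B) (J : ClosedIdeal A) : ClosedIdeal B where
  toSubmodule :=
    (Submodule.span ℂ {x : B | ∃ b, ∃ j ∈ J, ∃ b', x = b * φ j * b'}).topologicalClosure
  mul_mem_left' c x hx := by
    refine map_mem_closure (f := fun y => c * y) (by fun_prop) hx fun y hy => ?_
    induction hy using Submodule.span_induction with
    | mem y hy =>
      obtain ⟨b, j, hj, b', rfl⟩ := hy
      exact Submodule.subset_span ⟨c * b, j, hj, b', by simp only [mul_assoc]⟩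
    | zero => simp
    | add y z _ _ hy hz => simp only [mul_add]; exact Submodule.add_mem _ hy hz
    | smul r y _ hy => simp only [mul_smul_comm]; exact Submodule.smul_mem _ _ hy
  mul_mem_right' {x} c hx := by
    refine map_mem_closure (f := fun y => y * c) (by fun_prop) hx fun y hy => ?_
    induction hy using Submodule.span_induction with
    | mem y hy =>
      obtain ⟨b, j, hj, b', rfl⟩ := hy
      exact Submodule.subset_span ⟨b, j, hj, b' * c, by simp only [mul_assoc]⟩
    | zero => simp
    | add y z _ _ hy hz => simp only [add_mul]; exact Submodule.add_mem _ hy hz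
    | smul r y _ hy => simp only [smul_mul_assoc]; exact Submodule.smul_mem _ _ hy
  isClosed' := Submodule.isClosed_topologicalClosure _

end ClosedIdeal

/-- For a closed `*`-subalgebra `E`, every `φ e` with `e ∈ E` is a limit of elements
`φ(e₁) φ(e) φ(e₂)` with `e₁, e₂ ∈ E`. -/
theorem mem_closure_of_approx {A : Type u} {B : Type v} [NonUnitalCStarAlgebra A]
    [NonUnitalCStarAlgebra B] (φ : A →⋆ₙₐ[ℂ] B) (E : NonUnitalStarSubalgebra ℂ A)
    (hE : IsClosed (E : Set A)) {e : A} (he : e ∈ E) :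
    φ e ∈ closure {x : B | ∃ e₁ ∈ E, ∃ e₂ ∈ E, x = φ e₁ * φ e * φ e₂} := by
  obtain ⟨l, hl, h1, h2, -⟩ := exists_approx_unit E hE
  have hc : Continuous φ := 
    AddMonoidHomClass.continuous_of_bound φ 1 fun a => by
      simpa using NonUnitalStarAlgHom.norm_apply_le φ a
  have t1 : Tendsto (fun d : E => φ ((d : A) * e)) l (𝓝 (φ e)) :=
    (hc.tendsto _).comp ((continuous_subtype_val.tendsto _).comp (h1 ⟨e, he⟩))
  refine isClosed_closure.mem_of_tendsto t1 (Eventually.of_forall fun d => ?_)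
  have t2 : Tendsto (fun d' : E => φ ((d : A) * e * d')) l (𝓝 (φ ((d : A) * e))) :=
    (hc.tendsto _).comp ((continuous_subtype_val.tendsto _).comp (h2 (d * (⟨e, he⟩ : E))))
  refine mem_closure_of_tendsto t2 (Eventually.of_forall fun d' => ?_)
  exact ⟨d, d.2, d', d'.2, by simp only [map_mul]⟩

namespace ClosedIdeal

variable {A : Type u} {B : Type v} [NonUnitalCStarAlgebra A] [NonUnitalCStarAlgebra B]

theorem apply_mem_map (φ : A →⋆ₙₐ[ℂ] B) (J : ClosedIdeal A) : ∀ a ∈ J, φ a ∈ J.map φ := by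
  intro a ha
  refine closure_mono ?_ (mem_closure_of_approx φ J.symm J.isClosed_symm ⟨ha, J.star_mem ha⟩)
  rintro x ⟨e₁, -, e₂, -, rfl⟩
  exact Submodule.subset_span ⟨_, a, ha, _, rfl⟩

/-- The restriction `φ|_J` of `φ`, from `J` to the closed linear span of `B φ(J) B`. -/
def restrict (φ : A →⋆ₙₐ[ℂ] B) (J : ClosedIdeal A) : J →⋆ₙₐ[ℂ] J.map φ where
  toFun a := ⟨φ a, J.apply_mem_map φ a a.2⟩
  map_smul' c a := Subtype.ext (map_smul φ c (a : A))
  map_zero' := Subtype.ext (map_zero φ)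
  map_add' a b := Subtype.ext (map_add φ (a : A) (b : A))
  map_mul' a b := Subtype.ext (map_mul φ (a : A) (b : A))
  map_star' a := Subtype.ext (map_star φ (a : A))

/-- The map from `A / J` to the quotient of `B` by the closed linear span of `B φ(J) B` induced
by `φ`. -/
def quotientMap (φ : A →⋆ₙₐ[ℂ] B) (J : ClosedIdeal A) :
    J.Quotient →⋆ₙₐ[ℂ] (J.map φ).Quotient :=
  Quotient.map φ J (J.map φ) (J.apply_mem_map φ)

end ClosedIdeal

/-! ### Hereditary subalgebras -/

/-- Positivity in a C⋆-algebra: being of the form `x⋆x`. -/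
def IsPosElem {A : Type u} [NonUnitalCStarAlgebra A] (a : A) : Prop := ∃ x : A, a = star x * x

section Hereditary

variable {A : Type u} {B : Type v} [NonUnitalCStarAlgebra A] [NonUnitalCStarAlgebra B]

/-- A `*`-subalgebra `E` is hereditary if `0 ≤ a ≤ e` and `e ∈ E` imply `a ∈ E`. -/
def IsHereditary (E : NonUnitalStarSubalgebra ℂ A) : Prop :=
  ∀ e ∈ E, ∀ a : A, IsPosElem a → IsPosElem (e - a) → a ∈ E

/-- The closed linear span of `φ(E) B φ(E)`. -/
def hereditaryImage (φ : A →⋆ₙₐ[ℂ] B) (E : NonUnitalStarSubalgebra ℂ A) :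
    NonUnitalStarSubalgebra ℂ B where
  toNonUnitalSubalgebra :=
    { (Submodule.span ℂ
        {x : B | ∃ e ∈ E, ∃ b, ∃ e' ∈ E, x = φ e * b * φ e'}).topologicalClosure with
      mul_mem' := by
        intro x y hx hy
        refine map_mem_closure₂ (f := fun p q : B => p * q) (by fun_prop) hx hy
          fun p hp q hq => ?_
        induction hp using Submodule.span_induction with
        | mem p hp =>
          obtain ⟨e, he, b, e', he', rfl⟩ := hp
          induction hq using Submodule.span_induction with
          | mem q hq =>
            obtain ⟨f, hf, c, f', hf', rfl⟩ := hq
            exact Submodule.subset_span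
              ⟨e, he, b * φ e' * φ f * c, f', hf', by simp only [mul_assoc]⟩
          | zero => simp
          | add y z _ _ hy hz => simp only [mul_add]; exact Submodule.add_mem _ hy hz
          | smul r y _ hy => simp only [mul_smul_comm]; exact Submodule.smul_mem _ _ hy
        | zero => simp
        | add y z _ _ hy hz => simp only [add_mul]; exact Submodule.add_mem _ hy hz
        | smul r y _ hy => simp only [smul_mul_assoc]; exact Submodule.smul_mem _ _ hy }
  star_mem' := by
    intro x hx
    refine map_mem_closure (f := fun p : B => star p) continuous_star hx fun p hp => ?_
    induction hp using Submodule.span_induction with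
    | mem p hp =>
      obtain ⟨e, he, b, e', he', rfl⟩ := hp
      exact Submodule.subset_span ⟨star e', star_mem he', star b, star e, star_mem he, by
        simp only [star_mul, map_star, mul_assoc]⟩
    | zero => simp
    | add y z _ _ hy hz => simp only [star_add]; exact Submodule.add_mem _ hy hz
    | smul r y _ hy => simp only [star_smul]; exact Submodule.smul_mem _ _ hy

instance isClosed_hereditaryImage (φ : A →⋆ₙₐ[ℂ] B) (E : NonUnitalStarSubalgebra ℂ A) :
    IsClosed (hereditaryImage φ E : Set B) := isClosed_closure

theorem apply_mem_hereditaryImage (φ : A →⋆ₙₐ[ℂ] B) (E : NonUnitalStarSubalgebra ℂ A)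
    [hE : IsClosed (E : Set A)] {e : A} (he : e ∈ E) : φ e ∈ hereditaryImage φ E := by
  refine closure_mono ?_ (mem_closure_of_approx φ E hE he)
  rintro x ⟨e₁, h₁, e₂, h₂, rfl⟩
  exact Submodule.subset_span ⟨e₁, h₁, _, e₂, h₂, rfl⟩

/-- The restriction `φ|_E` of `φ`, from `E` to the closed linear span of `φ(E) B φ(E)`. -/
def hereditaryRestrict (φ : A →⋆ₙₐ[ℂ] B) (E : NonUnitalStarSubalgebra ℂ A)
    [IsClosed (E : Set A)] : E →⋆ₙₐ[ℂ] hereditaryImage φ E :=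
  NonUnitalStarAlgHom.codRestrict (φ.comp (NonUnitalStarSubalgebraClass.subtype E))
    (hereditaryImage φ E) fun e => apply_mem_hereditaryImage φ E e.2

end Hereditary

/-! ### Sequence algebras and sequentially split `*`-homomorphisms -/

section SeqAlg

variable (A : Type u) [NonUnitalCStarAlgebra A]

/-- The ideal `c₀(ℕ, A)` of `ℓ^∞(ℕ, A)`. -/
def nullSequences : ClosedIdeal (lp (fun _ : ℕ => A) ∞) where
  carrier := {a | Tendsto (fun n => ‖a n‖) atTop (𝓝 0)}
  add_mem' {a b} ha hb := by
    refine squeeze_zero (fun _ => norm_nonneg _) (fun n => ?_) (by simpa using ha.add hb)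
    exact norm_add_le (a n) (b n)
  zero_mem' := by simp
  smul_mem' c a ha := by
    have := ha.const_mul ‖c‖
    rw [mul_zero] at this
    exact this.congr fun n => (norm_smul c (a n)).symm
  mul_mem_left' a j hj := by
    have hj : Tendsto (fun n => ‖j n‖) atTop (𝓝 0) := hj
    refine squeeze_zero (fun _ => norm_nonneg _) (fun n => ?_)
      (by simpa using hj.const_mul ‖a‖)
    exact (norm_mul_le (a n) (j n)).trans
      (mul_le_mul_of_nonneg_right (lp.norm_apply_le_norm ENNReal.top_ne_zero a n) (norm_nonneg _))
  mul_mem_right' {j} a hj := by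
    have hj : Tendsto (fun n => ‖j n‖) atTop (𝓝 0) := hj
    refine squeeze_zero (fun _ => norm_nonneg _) (fun n => ?_)
      (by simpa using hj.mul_const ‖a‖)
    exact (norm_mul_le (j n) (a n)).trans
      (mul_le_mul_of_nonneg_left (lp.norm_apply_le_norm ENNReal.top_ne_zero a n) (norm_nonneg _))
  isClosed' := by
    refine isClosed_of_closure_subset fun a ha => ?_
    refine Metric.tendsto_atTop.2 fun ε hε => ?_
    obtain ⟨b, hb, hab⟩ := Metric.mem_closure_iff.1 ha (ε / 2) (half_pos hε)
    obtain ⟨N, hN⟩ := Metric.tendsto_atTop.1 hb (ε / 2) (half_pos hε)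
    refine ⟨N, fun n hn => ?_⟩
    have h1 := hN n hn
    rw [dist_zero_right, norm_norm] at h1 ⊢
    rw [dist_eq_norm] at hab
    have h2 : ‖a n - b n‖ ≤ ‖a - b‖ := lp.norm_apply_le_norm ENNReal.top_ne_zero (a - b) n
    have h3 : ‖a n‖ ≤ ‖a n - b n‖ + ‖b n‖ := by simpa using norm_add_le (a n - b n) (b n)
    linarith

/-- The sequence algebra `A_∞ = ℓ^∞(ℕ, A) / c₀(ℕ, A)`. -/
abbrev SeqAlg : Type u := (nullSequences A).Quotient

variable {A}

/-- A constant sequence. -/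
def constSeq (a : A) : lp (fun _ : ℕ => A) ∞ :=
  ⟨fun _ => a, memℓp_infty ⟨‖a‖, by rintro _ ⟨_, rfl⟩; exact le_rfl⟩⟩

variable (A)

/-- The canonical inclusion `A → A_∞` as constant sequences. -/
def seqIncl : A →⋆ₙₐ[ℂ] SeqAlg A :=
  (ClosedIdeal.Quotient.mk (nullSequences A)).comp
    { toFun := constSeq
      map_smul' := fun _ _ => rfl
      map_zero' := rfl
      map_add' := fun _ _ => rfl
      map_mul' := fun _ _ => rfl
      map_star' := fun _ => rfl }

end SeqAlg

/-- A `*`-homomorphism `φ : A → B` is sequentially split if there is a `*`-homomorphism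
`ψ : B → A_∞` such that `ψ ∘ φ` is the canonical inclusion `A → A_∞`. -/
def SeqSplit {A : Type u} {B : Type v} [NonUnitalCStarAlgebra A] [NonUnitalCStarAlgebra B]
    (φ : A →⋆ₙₐ[ℂ] B) : Prop :=
  ∃ ψ : B →⋆ₙₐ[ℂ] SeqAlg A, ψ.comp φ = seqIncl A


/-! ### C⋆-seminorms and the maximal tensor product -/

/-- A C⋆-seminorm on a complex `*`-algebra. -/
structure CStarSeminorm (T : Type u) [NonUnitalRing T] [StarRing T] [Module ℂ T] extends
    Seminorm ℂ T where
  mul_le' : ∀ x y, toFun (x * y) ≤ toFun x * toFun y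
  star_mul_self' : ∀ x, toFun (star x * x) = toFun x * toFun x

namespace CStarSeminorm

section Basic

variable {T : Type u} [NonUnitalRing T] [StarRing T] [Module ℂ T]

instance : FunLike (CStarSeminorm T) T ℝ where
  coe p := p.toFun
  coe_injective p q h := by
    cases p with | mk p _ _ => cases q with | mk q _ _ =>
    have : p = q := DFunLike.coe_injective h
    subst this; rfl

instance : SeminormClass (CStarSeminorm T) ℂ T where
  map_add_le_add p := map_add_le_add p.toSeminorm
  map_zero p := map_zero p.toSeminorm
  map_neg_eq_map p := map_neg_eq_map p.toSeminorm
  map_smul_eq_mul p := map_smul_eq_mul p.toSeminorm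

theorem mul_le (p : CStarSeminorm T) (x y : T) : p (x * y) ≤ p x * p y := p.mul_le' x y

theorem star_mul_self (p : CStarSeminorm T) (x : T) : p (star x * x) = p x * p x :=
  p.star_mul_self' x

theorem apply_star (p : CStarSeminorm T) (x : T) : p (star x) = p x := by
  have key : ∀ y : T, p y ≤ p (star y) := by
    intro y
    rcases (apply_nonneg p y).eq_or_lt with h | h
    · rw [← h]; exact apply_nonneg p _
    · have h1 := p.mul_le (star y) y
      rw [star_mul_self] at h1
      exact le_of_mul_le_mul_right h1 h
  refine le_antisymm ?_ (key x)
  simpa using key (star x)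

/-- The zero seminorm. -/
def zero : CStarSeminorm T where
  toSeminorm := 0
  mul_le' _ _ := (mul_zero (0 : ℝ)).ge
  star_mul_self' _ := (mul_zero (0 : ℝ)).symm

/-- The `*`-algebra `T`, equipped with the seminorm `p`. -/
def Carrier (_p : CStarSeminorm T) : Type u := T

end Basic

variable {T : Type u} [NonUnitalRing T] [StarRing T] [Module ℂ T] (p : CStarSeminorm T)

instance : NonUnitalSeminormedRing p.Carrier :=
  { AddGroupSeminorm.toSeminormedAddCommGroup (E := T) p.toSeminorm.toAddGroupSeminorm,
    (inferInstance : NonUnitalRing T) with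
    norm_mul_le := p.mul_le }

instance : StarRing p.Carrier where
  star := (star : T → T)
  star_involutive := (star_star : ∀ x : T, star (star x) = x)
  star_mul := (star_mul : ∀ x y : T, star (x * y) = star y * star x)
  star_add := (star_add : ∀ x y : T, star (x + y) = star x + star y)

instance : NormedSpace ℂ p.Carrier :=
  { (inferInstance : Module ℂ T) with
    norm_smul_le := fun c x => (map_smul_eq_mul p.toSeminorm c x).le }

instance : NormedStarGroup p.Carrier where
  norm_star_le x := (p.apply_star x).le

/-- The C⋆-algebra obtained from `T` by dividing out the null space of `p` and completing. -/
def Completion : Type u := UniformSpace.Completion p.Carrier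

namespace Completion

instance : NormedAddCommGroup p.Completion :=
  inferInstanceAs (NormedAddCommGroup (UniformSpace.Completion p.Carrier))

instance : NormedSpace ℂ p.Completion :=
  inferInstanceAs (NormedSpace ℂ (UniformSpace.Completion p.Carrier))

instance : CompleteSpace p.Completion :=
  inferInstanceAs (CompleteSpace (UniformSpace.Completion p.Carrier))

/-- The canonical map from `T` to its completion. -/
def of (t : T) : p.Completion := UniformSpace.Completion.coe' (α := p.Carrier) t

theorem denseRange_of : DenseRange (of p) :=
  UniformSpace.Completion.denseRange_coe (α := p.Carrier)

theorem norm_of (t : T) : ‖of p t‖ = p t := UniformSpace.Completion.norm_coe (E := p.Carrier) t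

theorem of_add (s t : T) : of p (s + t) = of p s + of p t :=
  UniformSpace.Completion.coe_add (α := p.Carrier) s t

theorem of_zero : of p 0 = 0 := rfl

theorem of_smul (c : ℂ) (t : T) : of p (c • t) = c • of p t :=
  UniformSpace.Completion.coe_smul (X := p.Carrier) c t

instance : Mul p.Completion where
  mul := Function.curry <|
    (UniformSpace.Completion.isDenseInducing_coe.prodMap
      UniformSpace.Completion.isDenseInducing_coe).extend
      (fun q : p.Carrier × p.Carrier => of p (q.1 * q.2))

theorem of_mul (s t : T) : of p (s * t) = of p s * of p t :=
  ((UniformSpace.Completion.isDenseInducing_coe.prodMap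
    UniformSpace.Completion.isDenseInducing_coe).extend_eq
    ((UniformSpace.Completion.continuous_coe p.Carrier).comp
      (continuous_mul (M := p.Carrier))) (s, t)).symm

instance : ContinuousMul p.Completion where
  continuous_mul := by
    let m := (AddMonoidHom.mul : p.Carrier →+ p.Carrier →+ p.Carrier).compr₂
      UniformSpace.Completion.toCompl
    have : Continuous fun q : p.Carrier × p.Carrier => m q.1 q.2 :=
      (UniformSpace.Completion.continuous_coe p.Carrier).comp continuous_mul
    have di : IsDenseInducing
        (UniformSpace.Completion.toCompl : p.Carrier → UniformSpace.Completion p.Carrier) :=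
      UniformSpace.Completion.isDenseInducing_coe
    exact (di.extend_Z_bilin di this :)

instance : Star p.Completion where
  star := UniformSpace.Completion.map (fun t : p.Carrier => star t)

theorem continuous_star' : Continuous (fun q : p.Completion => star q) :=
  UniformSpace.Completion.continuous_map

theorem of_star (t : T) : of p (star t) = star (of p t) :=
  (UniformSpace.Completion.map_coe (f := fun t : p.Carrier => star t)
    (AddMonoidHomClass.isometry_of_norm (starAddEquiv : p.Carrier ≃+ p.Carrier)
      (fun x => norm_star x)).uniformContinuous t).symm

@[elab_as_elim]
theorem ind {P : p.Completion → Prop} (q : p.Completion) (hc : IsClosed {q | P q})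
    (h : ∀ t, P (of p t)) : P q :=
  (denseRange_of p).induction_on q hc h

@[elab_as_elim]
theorem ind₂ {P : p.Completion → p.Completion → Prop} (q r : p.Completion)
    (hc : IsClosed {q : p.Completion × p.Completion | P q.1 q.2})
    (h : ∀ s t, P (of p s) (of p t)) : P q r :=
  (denseRange_of p).induction_on₂ hc h q r

@[elab_as_elim]
theorem ind₃ {P : p.Completion → p.Completion → p.Completion → Prop} (q r s : p.Completion)
    (hc : IsClosed {q : p.Completion × p.Completion × p.Completion | P q.1 q.2.1 q.2.2})
    (h : ∀ s t u, P (of p s) (of p t) (of p u)) : P q r s :=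
  (denseRange_of p).induction_on₃ hc h q r s

instance : NonUnitalNormedRing p.Completion :=
  { (inferInstance : NormedAddCommGroup p.Completion) with
    mul := (· * ·)
    left_distrib := fun a b c => ind₃ p a b c (isClosed_eq (by fun_prop) (by fun_prop))
      fun a b c => by simp only [← of_mul, ← of_add, mul_add]
    right_distrib := fun a b c => ind₃ p a b c (isClosed_eq (by fun_prop) (by fun_prop))
      fun a b c => by simp only [← of_mul, ← of_add, add_mul]
    zero_mul := fun a => ind p a (isClosed_eq (by fun_prop) (by fun_prop))
      fun a => by rw [← of_zero, ← of_mul, zero_mul]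
    mul_zero := fun a => ind p a (isClosed_eq (by fun_prop) (by fun_prop))
      fun a => by rw [← of_zero, ← of_mul, mul_zero]
    mul_assoc := fun a b c => ind₃ p a b c (isClosed_eq (by fun_prop) (by fun_prop))
      fun a b c => by simp only [← of_mul, mul_assoc]
    norm_mul_le := fun a b => ind₂ p a b (isClosed_le (by fun_prop) (by fun_prop))
      fun a b => by rw [← of_mul, norm_of, norm_of, norm_of]; exact p.mul_le a b }

instance : StarRing p.Completion where
  star_involutive a := ind p a
    (isClosed_eq ((continuous_star' p).comp (continuous_star' p)) continuous_id)
      fun a => by rw [← of_star, ← of_star, star_star]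
  star_mul a b := ind₂ p a b
    (isClosed_eq ((continuous_star' p).comp (by fun_prop))
      (((continuous_star' p).comp continuous_snd).mul ((continuous_star' p).comp continuous_fst)))
      fun a b => by simp only [← of_star, ← of_mul, star_mul]
  star_add a b := ind₂ p a b
    (isClosed_eq ((continuous_star' p).comp (by fun_prop))
      (((continuous_star' p).comp continuous_fst).add ((continuous_star' p).comp continuous_snd)))
      fun a b => by simp only [← of_star, ← of_add, star_add]

instance : CStarRing p.Completion where
  norm_mul_self_le a := ind p a
    (isClosed_le (by fun_prop)
      (continuous_norm.comp ((continuous_star' p).mul continuous_id)))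
      fun a => by rw [← of_star, ← of_mul, norm_of, norm_of, p.star_mul_self]

instance [IsScalarTower ℂ T T] [SMulCommClass ℂ T T] [StarModule ℂ T] :
    NonUnitalCStarAlgebra p.Completion where
  smul_assoc c a b := ind₂ p a b
    (isClosed_eq ((continuous_fst.const_smul c).mul continuous_snd)
      ((continuous_fst.mul continuous_snd).const_smul c))
    fun a b => by simp only [smul_eq_mul, ← of_smul, ← of_mul, smul_mul_assoc]
  smul_comm c a b := ind₂ p a b
    (isClosed_eq ((continuous_fst.mul continuous_snd).const_smul c)
      (continuous_fst.mul (continuous_snd.const_smul c)))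
    fun a b => by simp only [smul_eq_mul, ← of_smul, ← of_mul, mul_smul_comm]
  star_smul c a := ind p a
    (isClosed_eq ((continuous_star' p).comp (continuous_id.const_smul c))
      ((continuous_star' p).const_smul (star c)))
    fun a => by simp only [← of_star, ← of_smul, star_smul]

variable {S : Type v} [NonUnitalRing S] [StarRing S] [Module ℂ S]

/-- The function underlying `CStarSeminorm.Completion.map`. -/
def mapFun (p : CStarSeminorm T) (q : CStarSeminorm S) (f : T →⋆ₙₐ[ℂ] S) :
    p.Completion → q.Completion :=
  UniformSpace.Completion.map (α := p.Carrier) (β := q.Carrier) f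

theorem continuous_mapFun (p : CStarSeminorm T) (q : CStarSeminorm S) (f : T →⋆ₙₐ[ℂ] S) :
    Continuous (mapFun p q f) :=
  UniformSpace.Completion.continuous_map (α := p.Carrier) (β := q.Carrier)

theorem mapFun_of (p : CStarSeminorm T) (q : CStarSeminorm S) (f : T →⋆ₙₐ[ℂ] S)
    (hf : ∀ t, q (f t) ≤ p t) (t : T) : mapFun p q f (of p t) = of q (f t) :=
  let F : p.Carrier →ₗ[ℂ] q.Carrier :=
    { toFun := fun t => f t, map_add' := map_add f, map_smul' := map_smul f }
  UniformSpace.Completion.map_coe (f := F)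
    (F.mkContinuous 1 fun t => by rw [one_mul]; exact hf t).uniformContinuous t

/-- The `*`-homomorphism between completions extending a `*`-homomorphism `f` that does not
increase the seminorms. -/
def map (p : CStarSeminorm T) (q : CStarSeminorm S) (f : T →⋆ₙₐ[ℂ] S)
    (hf : ∀ t, q (f t) ≤ p t) : p.Completion →⋆ₙₐ[ℂ] q.Completion where
  toFun := mapFun p q f
  map_smul' c a := ind p a
    (isClosed_eq ((continuous_mapFun p q f).comp (continuous_id.const_smul c))
      ((continuous_mapFun p q f).const_smul c))
    fun a => by simp only [← of_smul, mapFun_of p q f hf, map_smul, MonoidHom.id_apply]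
  map_zero' := by rw [← of_zero p, mapFun_of p q f hf, map_zero, of_zero]
  map_add' a b := ind₂ p a b
    (isClosed_eq ((continuous_mapFun p q f).comp (continuous_fst.add continuous_snd))
      (((continuous_mapFun p q f).comp continuous_fst).add
        ((continuous_mapFun p q f).comp continuous_snd)))
    fun a b => by simp only [← of_add, mapFun_of p q f hf, map_add]
  map_mul' a b := ind₂ p a b
    (isClosed_eq ((continuous_mapFun p q f).comp (continuous_fst.mul continuous_snd))
      (((continuous_mapFun p q f).comp continuous_fst).mul
        ((continuous_mapFun p q f).comp continuous_snd)))
    fun a b => by simp only [← of_mul, mapFun_of p q f hf, map_mul]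
  map_star' a := ind p a
    (isClosed_eq ((continuous_mapFun p q f).comp (continuous_star' p))
      ((continuous_star' q).comp (continuous_mapFun p q f)))
    fun a => by simp only [← of_star, mapFun_of p q f hf, map_star]

theorem map_of (p : CStarSeminorm T) (q : CStarSeminorm S) (f : T →⋆ₙₐ[ℂ] S)
    (hf : ∀ t, q (f t) ≤ p t) (t : T) : map p q f hf (of p t) = of q (f t) :=
  mapFun_of p q f hf t

end Completion

/-- C⋆-seminorms are monotone: `x⋆x ≤ z⋆z` implies `p x ≤ p z`. -/
theorem le_of_add [IsScalarTower ℂ T T] [SMulCommClass ℂ T T] [StarModule ℂ T] (x z y : T) (h : star z * z = star x * x + star y * y) : p x ≤ p z := by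
  let _ : PartialOrder p.Completion := CStarAlgebra.spectralOrder p.Completion
  have : StarOrderedRing p.Completion := CStarAlgebra.spectralOrderedRing p.Completion
  have h1 : star (Completion.of p x) * Completion.of p x ≤
      star (Completion.of p z) * Completion.of p z := by
    have := congrArg (Completion.of p) h
    rw [Completion.of_add, Completion.of_mul, Completion.of_mul, Completion.of_mul,
      Completion.of_star, Completion.of_star, Completion.of_star] at this
    rw [this]
    exact le_add_of_nonneg_right (star_mul_self_nonneg _)
  have h2 := CStarAlgebra.norm_le_norm_of_nonneg_of_le (star_mul_self_nonneg _) h1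
  rw [CStarRing.norm_star_mul_self, CStarRing.norm_star_mul_self, Completion.norm_of,
    Completion.norm_of] at h2
  exact le_of_sq_le_sq (by rw [sq, sq]; exact h2) (apply_nonneg p z)

end CStarSeminorm

section Tensor

variable {A : Type u} {C : Type v} [NonUnitalCStarAlgebra A] [NonUnitalCStarAlgebra C]

theorem exists_compl_mul (a e : A) :
    ∃ y : A, (‖a‖ ^ 2 : ℂ) • (star e * e) = star (a * e) * (a * e) + star y * y := by
  let _ : PartialOrder A := CStarAlgebra.spectralOrder A
  have : StarOrderedRing A := CStarAlgebra.spectralOrderedRing A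
  have h := CStarAlgebra.star_left_conjugate_le_norm_smul (a := e) (b := star a * a)
    (IsSelfAdjoint.star_mul_self a)
  rw [← sub_nonneg] at h
  obtain ⟨y, hy⟩ := CStarAlgebra.nonneg_iff_eq_star_mul_self.1 h
  refine ⟨y, ?_⟩
  rw [← hy, CStarRing.norm_star_mul_self, star_mul, ← Complex.coe_smul]
  simp only [mul_assoc, Complex.ofReal_mul, sq]
  abel

/-- Every C⋆-seminorm on the algebraic tensor product is a subcross seminorm. -/
theorem CStarSeminorm.tmul_le (p : CStarSeminorm (A ⊗[ℂ] C)) (a : A) (c : C) :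
    p (a ⊗ₜ c) ≤ ‖a‖ * ‖c‖ := by
  have hA : ∀ (a e : A) (d : C), p ((a * e) ⊗ₜ d) ≤ ‖a‖ * p (e ⊗ₜ d) := by
    intro a e d
    obtain ⟨y, hy⟩ := exists_compl_mul a e
    have := p.le_of_add ((a * e) ⊗ₜ d) ((‖a‖ : ℂ) • (e ⊗ₜ d)) (y ⊗ₜ d) (by
      simp only [star_smul, TensorProduct.star_tmul, smul_mul_smul_comm,
        Algebra.TensorProduct.tmul_mul_tmul, ← TensorProduct.add_tmul, ← hy,
        TensorProduct.smul_tmul', Complex.star_def, Complex.conj_ofReal, sq])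
    rwa [map_smul_eq_mul, Complex.norm_real, norm_norm] at this
  have hC : ∀ (c d : C) (e : A), p (e ⊗ₜ (c * d)) ≤ ‖c‖ * p (e ⊗ₜ d) := by
    intro c d e
    obtain ⟨y, hy⟩ := exists_compl_mul c d
    have := p.le_of_add (e ⊗ₜ (c * d)) ((‖c‖ : ℂ) • (e ⊗ₜ d)) (e ⊗ₜ y) (by
      simp only [star_smul, TensorProduct.star_tmul, smul_mul_smul_comm,
        Algebra.TensorProduct.tmul_mul_tmul, ← TensorProduct.tmul_add, ← hy,
        TensorProduct.tmul_smul, Complex.star_def, Complex.conj_ofReal, sq])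
    rwa [map_smul_eq_mul, Complex.norm_real, norm_norm] at this
  have hsa : ∀ (a : A) (c : C), star a = a → star c = c → p (a ⊗ₜ c) ≤ ‖a‖ * ‖c‖ := by
    intro a c ha hc
    have h0 := apply_nonneg p (a ⊗ₜ c)
    rcases h0.eq_or_lt with h | h
    · rw [← h]; positivity
    have h1 := p.star_mul_self (a ⊗ₜ c)
    rw [TensorProduct.star_tmul, ha, hc, Algebra.TensorProduct.tmul_mul_tmul] at h1
    have h2 := (hA a a (c * c)).trans (mul_le_mul_of_nonneg_left (hC c c a) (norm_nonneg a))
    rw [h1, ← mul_assoc] at h2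
    exact le_of_mul_le_mul_right h2 h
  have h1 := p.star_mul_self (a ⊗ₜ c)
  have h2 := hsa (star a * a) (star c * c) (by simp) (by simp)
  rw [TensorProduct.star_tmul, Algebra.TensorProduct.tmul_mul_tmul] at h1
  rw [h1, CStarRing.norm_star_mul_self, CStarRing.norm_star_mul_self] at h2
  refine le_of_sq_le_sq ?_ (by positivity)
  nlinarith

theorem CStarSeminorm.bddAbove (x : A ⊗[ℂ] C) :
    BddAbove (Set.range fun p : CStarSeminorm (A ⊗[ℂ] C) => p x) := by
  induction x with
  | zero => exact ⟨0, by rintro _ ⟨p, rfl⟩; exact (map_zero p).le⟩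
  | tmul a c => exact ⟨‖a‖ * ‖c‖, by rintro _ ⟨p, rfl⟩; exact p.tmul_le a c⟩
  | add x y hx hy =>
    obtain ⟨M, hM⟩ := hx
    obtain ⟨N, hN⟩ := hy
    refine ⟨M + N, ?_⟩
    rintro _ ⟨p, rfl⟩
    exact (map_add_le_add p x y).trans (add_le_add (hM ⟨p, rfl⟩) (hN ⟨p, rfl⟩))

instance : Nonempty (CStarSeminorm (A ⊗[ℂ] C)) := ⟨CStarSeminorm.zero⟩

variable (A C)

/-- The maximal C⋆-norm on the algebraic tensor product: the supremum of all C⋆-seminorms. -/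
def maxTensorNorm : CStarSeminorm (A ⊗[ℂ] C) where
  toFun x := ⨆ p : CStarSeminorm (A ⊗[ℂ] C), p x
  map_zero' := by simp
  add_le' x y := ciSup_le fun p => (map_add_le_add p x y).trans
    (add_le_add (le_ciSup (CStarSeminorm.bddAbove x) p) (le_ciSup (CStarSeminorm.bddAbove y) p))
  neg' x := by simp
  smul' c x := by
    simp only [map_smul_eq_mul]
    rw [Real.mul_iSup_of_nonneg (norm_nonneg c)]
  mul_le' x y := ciSup_le fun p => (p.mul_le x y).trans
    (mul_le_mul (le_ciSup (CStarSeminorm.bddAbove x) p) (le_ciSup (CStarSeminorm.bddAbove y) p)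
      (apply_nonneg p y) (Real.iSup_nonneg fun p => apply_nonneg p x))
  star_mul_self' x := by
    have h0 : 0 ≤ ⨆ p : CStarSeminorm (A ⊗[ℂ] C), p x := Real.iSup_nonneg fun p => apply_nonneg p x
    have h1 : 0 ≤ ⨆ p : CStarSeminorm (A ⊗[ℂ] C), p (star x * x) :=
      Real.iSup_nonneg fun p => apply_nonneg p _
    refine le_antisymm (ciSup_le fun p => ?_) ?_
    · rw [p.star_mul_self]
      have := le_ciSup (CStarSeminorm.bddAbove x) p
      exact mul_le_mul this this (apply_nonneg p x) h0
    · rw [← sq]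
      refine (Real.le_sqrt h0 h1).1 (ciSup_le fun p => ?_)
      refine Real.le_sqrt_of_sq_le ?_
      rw [sq, ← p.star_mul_self]
      exact le_ciSup (CStarSeminorm.bddAbove (star x * x)) p

theorem le_maxTensorNorm (p : CStarSeminorm (A ⊗[ℂ] C)) (x : A ⊗[ℂ] C) :
    p x ≤ maxTensorNorm A C x :=
  le_ciSup (CStarSeminorm.bddAbove x) p

/-- The maximal tensor product `A ⊗_max C`. -/
def MaxTensor : Type (max u v) := (maxTensorNorm A C).Completion

instance : NonUnitalCStarAlgebra (MaxTensor A C) :=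
  inferInstanceAs (NonUnitalCStarAlgebra (maxTensorNorm A C).Completion)

end Tensor

namespace MaxTensor

variable {A : Type u} {B : Type v} {C : Type w} {D : Type x} [NonUnitalCStarAlgebra A]
  [NonUnitalCStarAlgebra B] [NonUnitalCStarAlgebra C] [NonUnitalCStarAlgebra D]

/-- The map `φ ⊙ ρ` between algebraic tensor products. -/
def algMap (φ : A →⋆ₙₐ[ℂ] B) (ρ : C →⋆ₙₐ[ℂ] D) : A ⊗[ℂ] C →⋆ₙₐ[ℂ] B ⊗[ℂ] D :=
  { TensorProduct.map (φ : A →ₗ[ℂ] B) (ρ : C →ₗ[ℂ] D) with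
    toFun := TensorProduct.map (φ : A →ₗ[ℂ] B) (ρ : C →ₗ[ℂ] D)
    map_zero' := map_zero _
    map_smul' := map_smul (TensorProduct.map (φ : A →ₗ[ℂ] B) (ρ : C →ₗ[ℂ] D))
    map_mul' := fun x y => by
      induction x with
      | zero => simp
      | add x x' hx hx' => simp only [add_mul, map_add, hx, hx']
      | tmul a c =>
        induction y with
        | zero => simp
        | add y y' hy hy' => simp only [mul_add, map_add, hy, hy']
        | tmul b d => simp
    map_star' := fun x => by
      induction x with
      | zero => simp
      | add x x' hx hx' => simp only [star_add, map_add, hx, hx']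
      | tmul a c => simp [map_star] }

theorem algMap_tmul (φ : A →⋆ₙₐ[ℂ] B) (ρ : C →⋆ₙₐ[ℂ] D) (a : A) (c : C) :
    algMap φ ρ (a ⊗ₜ c) = φ a ⊗ₜ ρ c := rfl

theorem algMap_le (φ : A →⋆ₙₐ[ℂ] B) (ρ : C →⋆ₙₐ[ℂ] D) (t : A ⊗[ℂ] C) :
    maxTensorNorm B D (algMap φ ρ t) ≤ maxTensorNorm A C t :=
  ciSup_le fun p =>
    le_maxTensorNorm A C
      { toFun := fun x => p (algMap φ ρ x)
        map_zero' := by simp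
        add_le' := fun x y => by rw [map_add]; exact map_add_le_add p _ _
        neg' := fun x => by rw [map_neg]; exact map_neg_eq_map p _
        smul' := fun c x => by rw [map_smul]; exact map_smul_eq_mul p _ _
        mul_le' := fun x y => by rw [map_mul]; exact p.mul_le _ _
        star_mul_self' := fun x => by rw [map_mul, map_star]; exact p.star_mul_self _ } t

/-- The canonical map from the algebraic to the maximal tensor product. -/
def of (t : A ⊗[ℂ] C) : MaxTensor A C := CStarSeminorm.Completion.of (maxTensorNorm A C) t

/-- The `*`-homomorphism `φ ⊗ ρ : A ⊗_max C → B ⊗_max D`. -/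
def map (φ : A →⋆ₙₐ[ℂ] B) (ρ : C →⋆ₙₐ[ℂ] D) : MaxTensor A C →⋆ₙₐ[ℂ] MaxTensor B D :=
  CStarSeminorm.Completion.map (maxTensorNorm A C) (maxTensorNorm B D) (algMap φ ρ)
    (algMap_le φ ρ)

theorem map_of_tmul (φ : A →⋆ₙₐ[ℂ] B) (ρ : C →⋆ₙₐ[ℂ] D) (a : A) (c : C) :
    map φ ρ (of (a ⊗ₜ c)) = of (φ a ⊗ₜ ρ c) :=
  CStarSeminorm.Completion.map_of _ _ (algMap φ ρ) (algMap_le φ ρ) (a ⊗ₜ c)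

end MaxTensor


/-! ### The Cuntz semigroup -/

/-- The Hilbert space `ℓ²(ℕ)`. -/
abbrev HilbertSeq : Type := lp (fun _ : ℕ => ℂ) 2

/-- The compact operators on `ℓ²(ℕ)`, as a closed ideal of the bounded operators. -/
def compactOps : ClosedIdeal (HilbertSeq →L[ℂ] HilbertSeq) where
  carrier := {T | IsCompactOperator T}
  add_mem' ha hb := ha.add hb
  zero_mem' := isCompactOperator_zero
  smul_mem' c _ ha := ha.smul c
  mul_mem_left' a _ hj := hj.clm_comp a
  mul_mem_right' a hj := hj.comp_clm a
  isClosed' := isClosed_setOfPred_isCompactOperator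

/-- The C⋆-algebra `𝒦` of compact operators on `ℓ²(ℕ)`. -/
def CompactOp : Type := compactOps

instance : NonUnitalCStarAlgebra CompactOp := inferInstanceAs (NonUnitalCStarAlgebra compactOps)

/-- The stabilisation `A ⊗ 𝒦`. As `𝒦` is nuclear, there is only one C⋆-tensor product. -/
abbrev Stabilization (A : Type u) [NonUnitalCStarAlgebra A] : Type u := MaxTensor A CompactOp

section Cuntz

variable {A : Type u} {B : Type v} [NonUnitalCStarAlgebra A] [NonUnitalCStarAlgebra B]

/-- Cuntz subequivalence: `a ≾ b` if `v b v⋆` can be chosen arbitrarily close to `a`. -/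
def CuntzLE (a b : A) : Prop := ∀ ε : ℝ, 0 < ε → ∃ v : A, ‖v * b * star v - a‖ < ε

theorem CuntzLE.refl (a : A) : CuntzLE a a := by
  intro ε hε
  obtain ⟨l, hl, h1, h2, hs, hn, -⟩ :=
    exists_approx_unit (⊤ : NonUnitalStarSubalgebra ℂ A) isClosed_univ
  let a' : (⊤ : NonUnitalStarSubalgebra ℂ A) := ⟨a, trivial⟩
  have t1 := Metric.tendsto_nhds.1 (h1 a') (ε / 2) (half_pos hε)
  have t2 := Metric.tendsto_nhds.1 (h2 a') (ε / 2) (half_pos hε)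
  obtain ⟨e, he1, he2, hse, hne⟩ := (t1.and (t2.and (hs.and hn))).exists
  have he1' : ‖(e : A) * a - a‖ < ε / 2 := by simpa [dist_eq_norm] using he1
  have he2' : ‖a * (e : A) - a‖ < ε / 2 := by simpa [dist_eq_norm] using he2
  have hse' : star (e : A) = e := congrArg Subtype.val hse
  refine ⟨e, ?_⟩
  have e1 : (e : A) * a * star (e : A) - a =
      ((e : A) * a - a) * (e : A) + (a * (e : A) - a) := by
    rw [hse', sub_mul]; abel
  rw [e1]
  calc _ ≤ ‖(e : A) * a - a‖ * ‖(e : A)‖ + ‖a * (e : A) - a‖ :=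
        (norm_add_le _ _).trans (add_le_add_left (norm_mul_le _ _) _)
    _ < ε := by nlinarith [norm_nonneg ((e : A) * a - a)]

theorem CuntzLE.trans {a b c : A} (h₁ : CuntzLE a b) (h₂ : CuntzLE b c) : CuntzLE a c := by
  intro ε hε
  obtain ⟨v, hv⟩ := h₁ (ε / 2) (half_pos hε)
  obtain ⟨y, hy⟩ := h₂ (ε / 2 / (‖v‖ * ‖v‖ + 1)) (by positivity)
  refine ⟨v * y, ?_⟩
  have e : v * y * c * star (v * y) - a =
      v * (y * c * star y - b) * star v + (v * b * star v - a) := by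
    simp only [star_mul, mul_sub, sub_mul, mul_assoc]
    abel
  rw [e]
  have h3 : ‖v * (y * c * star y - b) * star v‖ ≤ ‖v‖ * ‖y * c * star y - b‖ * ‖v‖ := by
    refine (norm_mul_le _ _).trans ?_
    rw [norm_star]
    gcongr
    exact norm_mul_le _ _
  have h4 : ‖v‖ * ‖y * c * star y - b‖ * ‖v‖ ≤ ε / 2 := by
    rw [lt_div_iff₀ (by positivity)] at hy
    nlinarith [norm_nonneg (y * c * star y - b)]
  calc _ ≤ _ := norm_add_le _ _
    _ < ε := by linarith

variable (A) in
/-- The positive elements of `A ⊗ 𝒦`. -/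
def StablePos : Type u := {a : Stabilization A // IsPosElem a}

instance : Preorder (StablePos A) where
  le a b := CuntzLE a.1 b.1
  le_refl a := CuntzLE.refl a.1
  le_trans _ _ _ := CuntzLE.trans

variable (A) in
/-- The Cuntz semigroup `Cu(A)` as a partially ordered set: the positive elements of `A ⊗ 𝒦`
modulo Cuntz equivalence, ordered by Cuntz subequivalence. -/
abbrev Cu : Type u := Antisymmetrization (StablePos A) (· ≤ ·)

/-- The map on positive elements of the stabilisations given by `φ ⊗ id`. -/
def StablePos.map (φ : A →⋆ₙₐ[ℂ] B) : StablePos A →o StablePos B where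
  toFun a := ⟨MaxTensor.map φ (NonUnitalStarAlgHom.id ℂ CompactOp) a.1, by
    obtain ⟨y, hy⟩ := a.2
    exact ⟨MaxTensor.map φ (NonUnitalStarAlgHom.id ℂ CompactOp) y, by
      rw [hy, map_mul, map_star]⟩⟩
  monotone' a b h ε hε := by
    obtain ⟨v, hv⟩ := h ε hε
    refine ⟨MaxTensor.map φ (NonUnitalStarAlgHom.id ℂ CompactOp) v, ?_⟩
    rw [← map_star, ← map_mul, ← map_mul, ← map_sub]
    exact (NonUnitalStarAlgHom.norm_apply_le _ _).trans_lt hv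

/-- The map `Cu(φ) : Cu(A) → Cu(B)`, `⟨a⟩ ↦ ⟨(φ ⊗ id)(a)⟩`. -/
def Cu.map (φ : A →⋆ₙₐ[ℂ] B) : Cu A →o Cu B := (StablePos.map φ).antisymmetrization

end Cuntz

/-! ### K-theory -/

section KTheory

open Matrix

/-- Murray–von Neumann equivalence of projections in matrix algebras. -/
def MvN {R : Type u} [Ring R] [StarRing R] {ι κ : Type} [Fintype ι] [Fintype κ]
    (p : Matrix ι ι R) (q : Matrix κ κ R) : Prop :=
  ∃ v : Matrix ι κ R, v * vᴴ = p ∧ vᴴ * v = q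

variable (R : Type u) [Ring R] [StarRing R]

/-- Projections in matrices of arbitrary finite size over `R`. -/
structure ProjMat : Type u where
  size : ℕ
  mat : Matrix (Fin size) (Fin size) R
  isProj : IsStarProjection mat

variable {R}

section MvN

variable {ι κ μ ν : Type} [Fintype ι] [Fintype κ] [Fintype μ] [Fintype ν]

theorem MvN.refl {p : Matrix ι ι R} (hp : IsStarProjection p) : MvN p p :=
  have h : pᴴ = p := hp.isSelfAdjoint
  ⟨p, by rw [h]; exact hp.isIdempotentElem, by rw [h]; exact hp.isIdempotentElem⟩

theorem MvN.symm {p : Matrix ι ι R} {q : Matrix κ κ R} (h : MvN p q) : MvN q p := by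
  obtain ⟨v, h1, h2⟩ := h
  exact ⟨vᴴ, by rwa [conjTranspose_conjTranspose], by rwa [conjTranspose_conjTranspose]⟩

theorem MvN.trans {p : Matrix ι ι R} {q : Matrix κ κ R} {r : Matrix μ μ R}
    (hp : IsStarProjection p) (hr : IsStarProjection r)
    (h₁ : MvN p q) (h₂ : MvN q r) : MvN p r := by
  obtain ⟨v, h1, h2⟩ := h₁
  obtain ⟨y, h3, h4⟩ := h₂
  refine ⟨v * y, ?_, ?_⟩
  · calc v * y * (v * y)ᴴ = v * (y * yᴴ) * vᴴ := by
          rw [conjTranspose_mul]; simp only [Matrix.mul_assoc]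
      _ = (v * vᴴ) * (v * vᴴ) := by rw [h3, ← h2]; simp only [Matrix.mul_assoc]
      _ = p := by rw [h1]; exact hp.isIdempotentElem
  · calc (v * y)ᴴ * (v * y) = yᴴ * (vᴴ * v) * y := by
          rw [conjTranspose_mul]; simp only [Matrix.mul_assoc]
      _ = (yᴴ * y) * (yᴴ * y) := by rw [h2, ← h3]; simp only [Matrix.mul_assoc]
      _ = r := by rw [h4]; exact hr.isIdempotentElem

theorem MvN.reindex {p : Matrix ι ι R} (hp : IsStarProjection p) (e : ι ≃ κ) :
    MvN p (Matrix.reindex e e p) := by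
  have h : pᴴ = p := hp.isSelfAdjoint
  have h' : p * p = p := hp.isIdempotentElem
  refine ⟨p.submatrix id e.symm, ?_, ?_⟩
  · rw [conjTranspose_submatrix, h, Matrix.submatrix_mul_equiv, h', Matrix.submatrix_id_id]
  · rw [conjTranspose_submatrix, h]
    have := Matrix.submatrix_mul_equiv p p e.symm (Equiv.refl ι) e.symm
    rw [h'] at this
    exact this

theorem MvN.fromBlocks {p : Matrix ι ι R} {q : Matrix κ κ R} {p' : Matrix μ μ R}
    {q' : Matrix ν ν R} (h₁ : MvN p p') (h₂ : MvN q q') :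
    MvN (Matrix.fromBlocks p 0 0 q) (Matrix.fromBlocks p' 0 0 q') := by
  obtain ⟨v, h1, h2⟩ := h₁
  obtain ⟨y, h3, h4⟩ := h₂
  exact ⟨Matrix.fromBlocks v 0 0 y,
    by simp [fromBlocks_conjTranspose, fromBlocks_multiply, h1, h3],
    by simp [fromBlocks_conjTranspose, fromBlocks_multiply, h2, h4]⟩

theorem MvN.of_isEmpty [IsEmpty ι] [IsEmpty κ] (p : Matrix ι ι R) (q : Matrix κ κ R) : MvN p q :=
  ⟨0, Subsingleton.elim _ _, Subsingleton.elim _ _⟩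

theorem MvN.fromBlocks_empty [IsEmpty ι] {z : Matrix ι ι R} {q : Matrix κ κ R}
    (hs : IsStarProjection (Matrix.fromBlocks z 0 0 q)) :
    MvN (Matrix.fromBlocks z 0 0 q) q := by
  have := MvN.reindex hs (Equiv.emptySum ι κ)
  have e : Matrix.reindex (Equiv.emptySum ι κ) (Equiv.emptySum ι κ)
      (Matrix.fromBlocks z 0 0 q) = q := by
    ext i j; rfl
  rwa [e] at this

theorem MvN.map {S : Type v} [Ring S] [StarRing S] [Algebra ℂ R] [Algebra ℂ S] (f : R →⋆ₐ[ℂ] S)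
    {p : Matrix ι ι R} {q : Matrix κ κ R} (h : MvN p q) : MvN (p.map f) (q.map f) := by
  obtain ⟨y, rfl, rfl⟩ := h
  have h : (y.map f)ᴴ = yᴴ.map f := (Matrix.conjTranspose_map _ (map_star f)).symm
  exact ⟨y.map f, by rw [h, Matrix.map_mul], by rw [h, Matrix.map_mul]⟩

theorem IsStarProjection.fromBlocks {p : Matrix ι ι R} {q : Matrix κ κ R}
    (hp : IsStarProjection p) (hq : IsStarProjection q) :
    IsStarProjection (Matrix.fromBlocks p 0 0 q) := by
  have h1 : p * p = p := hp.isIdempotentElem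
  have h2 : q * q = q := hq.isIdempotentElem
  have h3 : pᴴ = p := hp.isSelfAdjoint
  have h4 : qᴴ = q := hq.isSelfAdjoint
  refine ⟨?_, ?_⟩
  · simp [IsIdempotentElem, fromBlocks_multiply, h1, h2]
  · simp [IsSelfAdjoint, star_eq_conjTranspose, fromBlocks_conjTranspose, h3, h4]

theorem IsStarProjection.reindex {p : Matrix ι ι R} (hp : IsStarProjection p) (e : ι ≃ κ) :
    IsStarProjection (Matrix.reindex e e p) := by
  have h1 : p * p = p := hp.isIdempotentElem
  have h3 : pᴴ = p := hp.isSelfAdjoint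
  refine ⟨?_, ?_⟩
  · simp [IsIdempotentElem, Matrix.submatrix_mul_equiv, h1]
  · simp [IsSelfAdjoint, star_eq_conjTranspose, h3]

end MvN

theorem map_reindex_fromBlocks {S : Type v} {ι κ μ : Type} [Ring S] [StarRing S] [Algebra ℂ R] [Algebra ℂ S]
    (f : R →⋆ₐ[ℂ] S) (p : Matrix ι ι R) (q : Matrix κ κ R) (e : ι ⊕ κ ≃ μ) :
    (Matrix.reindex e e (Matrix.fromBlocks p 0 0 q)).map f =
      Matrix.reindex e e (Matrix.fromBlocks (p.map f) 0 0 (q.map f)) := by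
  rw [Matrix.reindex_apply, Matrix.reindex_apply, ← Matrix.submatrix_map,
    Matrix.fromBlocks_map, Matrix.map_zero _ (map_zero f), Matrix.map_zero _ (map_zero f)]

instance ProjMat.setoid : Setoid (ProjMat R) where
  r p q := MvN p.mat q.mat
  iseqv := ⟨fun p => MvN.refl p.isProj, MvN.symm, fun {p _ r} => MvN.trans p.isProj r.isProj⟩

/-- The orthogonal sum `p ⊕ q = diag(p, q)`. -/
def ProjMat.add (p q : ProjMat R) : ProjMat R :=
  ⟨p.size + q.size, Matrix.reindex finSumFinEquiv finSumFinEquiv (Matrix.fromBlocks p.mat 0 0 q.mat),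
    (p.isProj.fromBlocks q.isProj).reindex _⟩

theorem ProjMat.mvN_add (p q : ProjMat R) :
    MvN (Matrix.fromBlocks p.mat 0 0 q.mat) (p.add q).mat :=
  MvN.reindex (p.isProj.fromBlocks q.isProj) _

/-- The projection in the algebra of `0 × 0` matrices. -/
def ProjMat.zero : ProjMat R := ⟨0, 0, IsStarProjection.zero _⟩

variable (R) in
/-- The Murray–von Neumann semigroup `V(R)`: equivalence classes of projections in matrices
over `R`. -/
def MvNSemigroup : Type u := Quotient (ProjMat.setoid (R := R))

namespace MvNSemigroup

instance : Add (MvNSemigroup R) where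
  add := Quotient.map₂ ProjMat.add fun p p' hp q q' hq =>
    ((p.mvN_add q).symm.trans (p.add q).isProj (p'.isProj.fromBlocks q'.isProj)
      (MvN.fromBlocks hp hq)).trans (p.add q).isProj (p'.add q').isProj (p'.mvN_add q')

instance : Zero (MvNSemigroup R) where
  zero := Quotient.mk _ ProjMat.zero

theorem add_comm' (a b : MvNSemigroup R) : a + b = b + a := by
  induction a using Quotient.inductionOn with | _ p
  induction b using Quotient.inductionOn with | _ q
  refine Quotient.sound ?_
  have h : MvN (Matrix.fromBlocks p.mat 0 0 q.mat) (Matrix.fromBlocks q.mat 0 0 p.mat) := by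
    have := MvN.reindex (p.isProj.fromBlocks q.isProj) (Equiv.sumComm _ _)
    simpa [Matrix.reindex_apply] using this
  exact ((p.mvN_add q).symm.trans (p.add q).isProj (q.isProj.fromBlocks p.isProj) h).trans
    (p.add q).isProj (q.add p).isProj (q.mvN_add p)

theorem zero_add' (a : MvNSemigroup R) : 0 + a = a := by
  induction a using Quotient.inductionOn with | _ q
  refine Quotient.sound ?_
  have h : MvN (Matrix.fromBlocks (ProjMat.zero (R := R)).mat 0 0 q.mat) q.mat :=
    MvN.fromBlocks_empty (ι := Fin 0) ((ProjMat.zero (R := R)).isProj.fromBlocks q.isProj)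
  exact ((ProjMat.zero.mvN_add q).symm.trans (ProjMat.zero.add q).isProj q.isProj h)

theorem add_assoc' (a b c : MvNSemigroup R) : a + b + c = a + (b + c) := by
  induction a using Quotient.inductionOn with | _ p
  induction b using Quotient.inductionOn with | _ q
  induction c using Quotient.inductionOn with | _ r
  refine Quotient.sound ?_
  have h : MvN (Matrix.fromBlocks (Matrix.fromBlocks p.mat 0 0 q.mat) 0 0 r.mat)
      (Matrix.fromBlocks p.mat 0 0 (Matrix.fromBlocks q.mat 0 0 r.mat)) := by
    have := MvN.reindex ((p.isProj.fromBlocks q.isProj).fromBlocks r.isProj) (Equiv.sumAssoc _ _ _)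
    convert this using 1
    ext i j
    rcases i with i | i | i <;> rcases j with j | j | j <;> rfl
  have h1 : MvN ((p.add q).add r).mat
      (Matrix.fromBlocks (Matrix.fromBlocks p.mat 0 0 q.mat) 0 0 r.mat) :=
    ((p.add q).mvN_add r).symm.trans ((p.add q).add r).isProj
      ((p.isProj.fromBlocks q.isProj).fromBlocks r.isProj)
      (MvN.fromBlocks (p.mvN_add q).symm (MvN.refl r.isProj))
  have h2 : MvN (Matrix.fromBlocks p.mat 0 0 (Matrix.fromBlocks q.mat 0 0 r.mat))
      (p.add (q.add r)).mat :=
    (MvN.fromBlocks (MvN.refl p.isProj) (q.mvN_add r)).trans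
      (p.isProj.fromBlocks (q.isProj.fromBlocks r.isProj)) (p.add (q.add r)).isProj (p.mvN_add (q.add r))
  exact (h1.trans ((p.add q).add r).isProj (p.isProj.fromBlocks (q.isProj.fromBlocks r.isProj)) h).trans
    ((p.add q).add r).isProj (p.add (q.add r)).isProj h2

instance : AddCommMonoid (MvNSemigroup R) where
  add_assoc := add_assoc'
  zero_add := zero_add'
  add_zero a := by rw [add_comm', zero_add']
  add_comm := add_comm'
  nsmul := nsmulRec

end MvNSemigroup

section Functoriality

variable {S : Type v} [Ring S] [StarRing S] [Algebra ℂ R] [Algebra ℂ S]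

/-- Entrywise application of a `*`-homomorphism to a projection. -/
def ProjMat.map (f : R →⋆ₐ[ℂ] S) (p : ProjMat R) : ProjMat S :=
  ⟨p.size, p.mat.map f, by
    have h1 : p.mat * p.mat = p.mat := p.isProj.isIdempotentElem
    have h2 : p.matᴴ = p.mat := p.isProj.isSelfAdjoint
    refine ⟨?_, ?_⟩
    · rw [IsIdempotentElem, ← Matrix.map_mul, h1]
    · rw [IsSelfAdjoint, star_eq_conjTranspose, ← Matrix.conjTranspose_map _ (map_star f), h2]⟩

/-- The additive map `V(R) → V(S)` induced by a `*`-homomorphism. -/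
def MvNSemigroup.map (f : R →⋆ₐ[ℂ] S) : MvNSemigroup R →+ MvNSemigroup S where
  toFun := Quotient.map (ProjMat.map f) fun _ _ h => MvN.map f h
  map_zero' := Quotient.sound (MvN.of_isEmpty (ι := Fin 0) (κ := Fin 0) _ _)
  map_add' a b := by
    induction a using Quotient.inductionOn with | _ p
    induction b using Quotient.inductionOn with | _ q
    refine Quotient.sound ?_
    have h : (ProjMat.map f (p.add q)).mat = ((p.map f).add (q.map f)).mat :=
      map_reindex_fromBlocks f p.mat q.mat finSumFinEquiv
    exact Eq.subst (motive := fun m => MvN (ProjMat.map f (p.add q)).mat m) h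
      (MvN.refl (ProjMat.map f (p.add q)).isProj)

end Functoriality

/-- `K₀` of a unital C⋆-algebra: the Grothendieck group of the Murray–von Neumann semigroup. -/
abbrev UnitalK0 (R : Type u) [CStarAlgebra R] : Type u :=
  Algebra.GrothendieckAddGroup (MvNSemigroup R)

/-- The group homomorphism `K₀(f)` for a unital `*`-homomorphism `f`. -/
def UnitalK0.map {R : Type u} {S : Type v} [CStarAlgebra R] [CStarAlgebra S] (f : R →⋆ₐ[ℂ] S) :
    UnitalK0 R →+ UnitalK0 S :=
  Algebra.GrothendieckAddGroup.lift
    ((Algebra.GrothendieckAddGroup.of (M := MvNSemigroup S)).comp (MvNSemigroup.map f))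

theorem UnitalK0.map_of {R : Type u} {S : Type v} [CStarAlgebra R] [CStarAlgebra S]
    (f : R →⋆ₐ[ℂ] S) (a : MvNSemigroup R) :
    UnitalK0.map f (Algebra.GrothendieckAddGroup.of a) =
      Algebra.GrothendieckAddGroup.of (MvNSemigroup.map f a) :=
  DFunLike.congr_fun (Algebra.GrothendieckAddGroup.lift.symm_apply_apply
    ((Algebra.GrothendieckAddGroup.of (M := MvNSemigroup S)).comp (MvNSemigroup.map f))) a

theorem UnitalK0.map_comp {R : Type u} {S : Type v} {Q : Type w} [CStarAlgebra R]
    [CStarAlgebra S] [CStarAlgebra Q] (g : S →⋆ₐ[ℂ] Q) (f : R →⋆ₐ[ℂ] S) :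
    UnitalK0.map (g.comp f) = (UnitalK0.map g).comp (UnitalK0.map f) := by
  apply Algebra.GrothendieckAddGroup.lift.symm.injective
  ext a
  have h : MvNSemigroup.map (g.comp f) a = MvNSemigroup.map g (MvNSemigroup.map f a) := by
    induction a using Quotient.inductionOn with | _ p
    rfl
  change UnitalK0.map (g.comp f) (Algebra.GrothendieckAddGroup.of a) =
    UnitalK0.map g (UnitalK0.map f (Algebra.GrothendieckAddGroup.of a))
  rw [UnitalK0.map_of, UnitalK0.map_of, UnitalK0.map_of, h]

end KTheory

section NonUnitalKTheory

variable {A : Type u} {B : Type v} [NonUnitalCStarAlgebra A] [NonUnitalCStarAlgebra B]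

variable (A) in
/-- The canonical character `A~ → ℂ` of the unitization. -/
def unitizationChar : Unitization ℂ A →⋆ₐ[ℂ] ℂ :=
  { Unitization.fstHom ℂ A with map_star' := fun _ => rfl }

variable (A) in
/-- `K₀(A)`: the kernel of `K₀(A~) → K₀(ℂ)`, where `A~` is the unitization. -/
def K0 : Type u := (UnitalK0.map (unitizationChar A)).ker

instance : AddCommGroup (K0 A) :=
  inferInstanceAs (AddCommGroup (UnitalK0.map (unitizationChar A)).ker)

/-- The group homomorphism `K₀(φ)`: the restriction of `K₀(φ~)`. -/
def K0.map (φ : A →⋆ₙₐ[ℂ] B) : K0 A →+ K0 B :=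
  ((UnitalK0.map (Unitization.starMap φ)).comp
    (UnitalK0.map (unitizationChar A)).ker.subtype).codRestrict
    (UnitalK0.map (unitizationChar B)).ker (by
      rintro ⟨y, hy⟩
      have h : (unitizationChar B).comp (Unitization.starMap φ) = unitizationChar A := by
        ext a
        simp [unitizationChar]
        rfl
      rw [AddMonoidHom.mem_ker] at hy ⊢
      rw [← h, UnitalK0.map_comp] at hy
      exact hy)

open scoped ZeroAtInfty in
variable (A) in
/-- The suspension `C₀(ℝ) ⊗ A`. As `C₀(ℝ)` is nuclear, there is only one C⋆-tensor product. -/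
abbrev Suspension : Type u := MaxTensor C₀(ℝ, ℂ) A

variable (A) in
/-- `K₁(A) = K₀(C₀(ℝ) ⊗ A)`. -/
abbrev K1 : Type u := K0 (Suspension A)

/-- The group homomorphism `K₁(φ)`. -/
def K1.map (φ : A →⋆ₙₐ[ℂ] B) : K1 A →+ K1 B :=
  K0.map (MaxTensor.map (NonUnitalStarAlgHom.id ℂ _) φ)

/-- The algebra `C₀(Wₙ)` of continuous functions on the Moore space of `ℤ/n` that vanish at the
base point. The Moore space is the closed unit disk with points `z, w` on the boundary
identified if `zⁿ = wⁿ`, and the base point is the class of `1`. Its `K`-theory is `K₀ = ℤ/n` and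
`K₁ = 0`. -/
def mooreAlgebra (n : ℕ) : NonUnitalStarSubalgebra ℂ C(Metric.closedBall (0 : ℂ) 1, ℂ) where
  carrier := {f | (∀ z y : Metric.closedBall (0 : ℂ) 1, ‖(z : ℂ)‖ = 1 → ‖(y : ℂ)‖ = 1 →
    (z : ℂ) ^ n = (y : ℂ) ^ n → f z = f y) ∧ ∀ z : Metric.closedBall (0 : ℂ) 1, (z : ℂ) = 1 → f z = 0}
  add_mem' {f g} hf hg := ⟨fun z y hz hy h => by
    simp [hf.1 z y hz hy h, hg.1 z y hz hy h], fun z hz => by simp [hf.2 z hz, hg.2 z hz]⟩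
  zero_mem' := ⟨fun _ _ _ _ _ => rfl, fun _ _ => rfl⟩
  mul_mem' {f g} hf hg := ⟨fun z y hz hy h => by
    simp [hf.1 z y hz hy h, hg.1 z y hz hy h], fun z hz => by simp [hf.2 z hz]⟩
  smul_mem' c f hf := ⟨fun z y hz hy h => by
    simp [hf.1 z y hz hy h], fun z hz => by simp [hf.2 z hz]⟩
  star_mem' {f} hf := ⟨fun z y hz hy h => by
    simp [hf.1 z y hz hy h], fun z hz => by simp [hf.2 z hz]⟩

instance isClosed_mooreAlgebra (n : ℕ) :
    IsClosed (mooreAlgebra n : Set C(Metric.closedBall (0 : ℂ) 1, ℂ)) := by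
  have : (mooreAlgebra n : Set C(Metric.closedBall (0 : ℂ) 1, ℂ)) =
      (⋂ (z : Metric.closedBall (0 : ℂ) 1) (y : Metric.closedBall (0 : ℂ) 1)
        (_ : ‖(z : ℂ)‖ = 1) (_ : ‖(y : ℂ)‖ = 1) (_ : (z : ℂ) ^ n = (y : ℂ) ^ n),
        {f : C(Metric.closedBall (0 : ℂ) 1, ℂ) | f z = f y}) ∩
      ⋂ (z : Metric.closedBall (0 : ℂ) 1) (_ : (z : ℂ) = 1), {f | f z = 0} := by
    ext f
    simp only [Set.mem_inter_iff, Set.mem_iInter, Set.mem_ofPred_eq]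
    exact Iff.rfl
  rw [this]
  refine IsClosed.inter ?_ ?_
  · exact isClosed_iInter fun z => isClosed_iInter fun y => isClosed_iInter fun _ =>
      isClosed_iInter fun _ => isClosed_iInter fun _ =>
        isClosed_eq (continuous_eval_const z) (continuous_eval_const y)
  · exact isClosed_iInter fun z => isClosed_iInter fun _ =>
      isClosed_eq (continuous_eval_const z) continuous_const

variable (A) in
/-- `K₀(A; ℤ/n) = K₀(A ⊗ C₀(Wₙ))`. As `C₀(Wₙ)` is nuclear, there is only one C⋆-tensor product. -/
abbrev K0Mod (n : ℕ) : Type u := K0 (MaxTensor A (mooreAlgebra n))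

variable (A) in
/-- `K₁(A; ℤ/n) = K₁(A ⊗ C₀(Wₙ))`. -/
abbrev K1Mod (n : ℕ) : Type u := K1 (MaxTensor A (mooreAlgebra n))

/-- The map induced by `φ` on `K₀` with coefficients in `ℤ/n`. -/
def K0Mod.map (n : ℕ) (φ : A →⋆ₙₐ[ℂ] B) : K0Mod A n →+ K0Mod B n :=
  K0.map (MaxTensor.map φ (NonUnitalStarAlgHom.id ℂ (mooreAlgebra n)))

/-- The map induced by `φ` on `K₁` with coefficients in `ℤ/n`. -/
def K1Mod.map (n : ℕ) (φ : A →⋆ₙₐ[ℂ] B) : K1Mod A n →+ K1Mod B n :=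
  K1.map (MaxTensor.map φ (NonUnitalStarAlgHom.id ℂ (mooreAlgebra n)))

end NonUnitalKTheory

/-! ### Tracial states -/

/-- A tracial state: a positive linear functional of norm one with `τ(ab) = τ(ba)`. -/
structure TracialState (A : Type u) [NonUnitalCStarAlgebra A] where
  toFun : A →L[ℂ] ℂ
  nonneg' : ∀ a : A, 0 ≤ (toFun (star a * a)).re ∧ (toFun (star a * a)).im = 0
  norm_eq_one' : ‖toFun‖ = 1
  trace' : ∀ a b : A, toFun (a * b) = toFun (b * a)

instance (A : Type u) [NonUnitalCStarAlgebra A] : CoeFun (TracialState A) (fun _ => A → ℂ) where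
  coe τ := τ.toFun

end

/-! A splitting `ψ : B → A_∞` turns exact data in `B` into approximate data in `A`. Apply `ψ` to the
data and lift to bounded sequences: every `*`-polynomial relation with coefficients in `φ(A)`
survives up to a null sequence, because `ψ` sends these coefficients back to constants. Each item is
either stable under small errors or passes to a limit. For subobjects `E ⊆ A`, injective
`*`-homomorphisms are isometric, so `E_∞` embeds in `A_∞` with closed range and meets the constants
in `E`. Entrywise, `e A e' ⊆ E` for a hereditary `E` and `A j A ⊆ J` for an ideal `J`. Hence `ψ`
maps the closed span of `φ(E) B φ(E)` into `E_∞` and that of `B φ(J) B` into `J_∞`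
(`apply_mem_range_of_mem_closure_span`). Restriction, passage to quotients and injectivity on ideals
follow. For tensor products, the universal property of the maximal norm gives a map from `A_∞ ⊗ C_∞`
to `(A ⊗ C)_∞` (`MaxTensor.exists_tensor_seqAlg_hom`), and composing it with `ψ ⊗ σ` splits `φ ⊗ ρ`.
With an identity as second factor, this reduces stabilisation, suspension and coefficients to
statements about a single split map. Cuntz subequivalence asks only for approximate witnesses, so an
entry of a lift is a witness (`SeqSplit.cuntzLE`). A tracial state `τ` extends to `A_∞` as a limit
along a free ultrafilter, and composing with `ψ` gives the trace on `B`. For `K₀`, extend `ψ` to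
unitizations. A partial isometry over `B~` lifts to matrices over `A~` that nearly implement an
equivalence, and functional calculus corrects one of them to an exact one (`MvN.of_norm_lt`,
`MvN.of_map`). So the map on Murray–von Neumann semigroups is injective. Injectivity survives in the
Grothendieck groups because a stabilising summand can be completed to a unit matrix, which comes
from `A~` (`UnitalK0.map_injective`). -/

noncomputable section

open Filter Topology
open scoped ENNReal TensorProduct

/-! ### `*`-homomorphisms and quotients -/

namespace NonUnitalStarAlgHom

variable {A : Type u} {B : Type v} [NonUnitalCStarAlgebra A] [NonUnitalCStarAlgebra B]

/-- `*`-homomorphisms between C⋆-algebras are continuous. -/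
theorem continuous_of_cstar (f : A →⋆ₙₐ[ℂ] B) : Continuous f :=
  AddMonoidHomClass.continuous_of_bound f 1 fun a => by
    simpa using NonUnitalStarAlgHom.norm_apply_le f a

/-- The range of an injective `*`-homomorphism is closed. -/
theorem isClosed_range_of_injective (f : A →⋆ₙₐ[ℂ] B) (hf : Function.Injective f) :
    IsClosed (Set.range f) :=
  (NonUnitalStarAlgHom.isometry f hf).isClosedEmbedding.isClosed_range

/-- A `*`-homomorphism `f` with values in the range of an injective `*`-homomorphism `i` factors
through `i`. -/
theorem exists_comp_eq_of_range_subset {C : Type w} [NonUnitalCStarAlgebra C]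
    (i : A →⋆ₙₐ[ℂ] B) (hi : Function.Injective i) (f : C →⋆ₙₐ[ℂ] B)
    (hf : ∀ c, f c ∈ Set.range i) : ∃ g : C →⋆ₙₐ[ℂ] A, ∀ c, i (g c) = f c := by
  -- Injectivity of `i` makes the choice unique, so each algebraic law for `g` can be checked after
  -- applying `i`.
  choose g hg using hf
  exact ⟨{
    toFun := g
    map_smul' := fun r c => hi (by simp [hg])
    map_zero' := hi (by simp [hg])
    map_add' := fun c d => hi (by simp [hg])
    map_mul' := fun c d => hi (by simp [hg])
    map_star' := fun c => hi (by simp [hg, map_star]) }, hg⟩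

end NonUnitalStarAlgHom

namespace ClosedIdeal

variable {A : Type u} {B : Type v} [NonUnitalCStarAlgebra A] [NonUnitalCStarAlgebra B]

/-- The `*`-homomorphism on `A / J` induced by one on `A` that vanishes on `J`. -/
def Quotient.lift (J : ClosedIdeal A) (f : A →⋆ₙₐ[ℂ] B) (h : ∀ a ∈ J, f a = 0) :
    J.Quotient →⋆ₙₐ[ℂ] B where
  toFun := _root_.Quotient.lift (fun a => f a) (by
    intro a a' ha
    rw [← Quotient.eq_iff_equiv] at ha
    have ha' : a - a' ∈ J := (Quotient.of_eq J).1 ha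
    rw [← sub_eq_zero, ← map_sub]
    exact h _ ha')
  map_smul' c q := by
    obtain ⟨a, rfl⟩ := Quotient.of_surjective J q
    exact map_smul f c a
  map_zero' := map_zero f
  map_add' p q := by
    obtain ⟨a, rfl⟩ := Quotient.of_surjective J p
    obtain ⟨b, rfl⟩ := Quotient.of_surjective J q
    exact map_add f a b
  map_mul' p q := by
    obtain ⟨a, rfl⟩ := Quotient.of_surjective J p
    obtain ⟨b, rfl⟩ := Quotient.of_surjective J q
    exact map_mul f a b
  map_star' q := by
    obtain ⟨a, rfl⟩ := Quotient.of_surjective J q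
    exact map_star f a

theorem Quotient.mk_surjective (J : ClosedIdeal A) : Function.Surjective (Quotient.mk J) :=
  Quotient.of_surjective J

theorem Quotient.mk_eq_zero (J : ClosedIdeal A) {a : A} : Quotient.mk J a = 0 ↔ a ∈ J := by
  have : Quotient.mk J a = 0 ↔ a - 0 ∈ J := Quotient.of_eq J
  rwa [sub_zero] at this

/-- The inclusion of a closed ideal. -/
def subtype (J : ClosedIdeal A) : J →⋆ₙₐ[ℂ] A where
  toFun a := a
  map_smul' _ _ := rfl
  map_zero' := rfl
  map_add' _ _ := rfl
  map_mul' _ _ := rfl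
  map_star' _ := rfl

theorem subtype_injective (J : ClosedIdeal A) : Function.Injective J.subtype :=
  Subtype.val_injective

end ClosedIdeal

/-! ### Functoriality of sequence algebras -/

section SeqAlgMap

variable {A : Type u} {B : Type v} [NonUnitalCStarAlgebra A] [NonUnitalCStarAlgebra B]

/-- The bounded sequence with given entries. -/
def boundedSeq (a : ℕ → A) (M : ℝ) (h : ∀ n, ‖a n‖ ≤ M) : lp (fun _ : ℕ => A) ∞ :=
  ⟨a, memℓp_infty ⟨M, by rintro _ ⟨n, rfl⟩; exact h n⟩⟩

/-- Entrywise application of a `*`-homomorphism to bounded sequences. -/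
def boundedSeqMap (f : A →⋆ₙₐ[ℂ] B) : lp (fun _ : ℕ => A) ∞ →⋆ₙₐ[ℂ] lp (fun _ : ℕ => B) ∞ where
  toFun a := boundedSeq (fun n => f (a n)) ‖a‖ fun n =>
    (NonUnitalStarAlgHom.norm_apply_le f _).trans (lp.norm_apply_le_norm ENNReal.top_ne_zero a n)
  map_smul' c a := by ext n; exact map_smul f c (a n)
  map_zero' := by ext n; exact map_zero f
  map_add' a b := by ext n; exact map_add f (a n) (b n)
  map_mul' a b := by ext n; exact map_mul f (a n) (b n)
  map_star' a := by ext n; exact map_star f (a n)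

theorem boundedSeqMap_apply (f : A →⋆ₙₐ[ℂ] B) (a : lp (fun _ : ℕ => A) ∞) (n : ℕ) :
    boundedSeqMap f a n = f (a n) := rfl

/-- The `*`-homomorphism `A_∞ → B_∞` induced by a `*`-homomorphism `A → B`. -/
def SeqAlg.map (f : A →⋆ₙₐ[ℂ] B) : SeqAlg A →⋆ₙₐ[ℂ] SeqAlg B :=
  ClosedIdeal.Quotient.map (boundedSeqMap f) (nullSequences A) (nullSequences B) fun a ha =>
    squeeze_zero (fun _ => norm_nonneg _) (fun n => NonUnitalStarAlgHom.norm_apply_le f (a n)) ha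

variable (A) in
/-- The class of a bounded sequence in `A_∞`. -/
abbrev SeqAlg.mk : lp (fun _ : ℕ => A) ∞ →⋆ₙₐ[ℂ] SeqAlg A :=
  ClosedIdeal.Quotient.mk (nullSequences A)

variable (A) in
theorem SeqAlg.mk_surjective : Function.Surjective (SeqAlg.mk A) :=
  ClosedIdeal.Quotient.mk_surjective _

theorem SeqAlg.mk_eq_zero {a : lp (fun _ : ℕ => A) ∞} :
    SeqAlg.mk A a = 0 ↔ Tendsto (fun n => ‖a n‖) atTop (𝓝 0) :=
  ClosedIdeal.Quotient.mk_eq_zero _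

theorem SeqAlg.mk_eq_mk {a b : lp (fun _ : ℕ => A) ∞} :
    SeqAlg.mk A a = SeqAlg.mk A b ↔ Tendsto (fun n => ‖a n - b n‖) atTop (𝓝 0) := by
  rw [← sub_eq_zero, ← map_sub, SeqAlg.mk_eq_zero]
  rfl

theorem seqIncl_apply (a : A) : seqIncl A a = SeqAlg.mk A (constSeq a) := rfl

theorem SeqAlg.map_mk (f : A →⋆ₙₐ[ℂ] B) (a : lp (fun _ : ℕ => A) ∞) :
    SeqAlg.map f (SeqAlg.mk A a) = SeqAlg.mk B (boundedSeqMap f a) := rfl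

theorem SeqAlg.map_seqIncl (f : A →⋆ₙₐ[ℂ] B) (a : A) :
    SeqAlg.map f (seqIncl A a) = seqIncl B (f a) := rfl

/-- Passing to sequence algebras preserves injectivity. -/
theorem SeqAlg.map_injective (f : A →⋆ₙₐ[ℂ] B) (hf : Function.Injective f) :
    Function.Injective (SeqAlg.map f) := by
  rw [injective_iff_map_eq_zero]
  intro q hq
  obtain ⟨a, rfl⟩ := SeqAlg.mk_surjective A q
  rw [SeqAlg.map_mk, SeqAlg.mk_eq_zero] at hq
  rw [SeqAlg.mk_eq_zero]
  -- An injective `*`-homomorphism is isometric, so `a` is null as soon as its image is.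
  exact hq.congr fun n => NonUnitalStarAlgHom.norm_map f hf (a n)

/-- If the class of a sequence has norm less than `ε`, then so do its entries eventually. -/
theorem SeqAlg.eventually_norm_lt {a : lp (fun _ : ℕ => A) ∞} {ε : ℝ}
    (h : ‖SeqAlg.mk A a‖ < ε) : ∀ᶠ n in atTop, ‖a n‖ < ε := by
  -- Half of the gap between `ε` and the quotient norm pays for the representative `b`, the other
  -- half for the null sequence `b - a`.
  obtain ⟨b, hb, hbn⟩ := ClosedIdeal.Quotient.exists_norm_lt (nullSequences A) (SeqAlg.mk A a)
    (half_pos (sub_pos.2 h))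
  have h1 : Tendsto (fun n => ‖b n - a n‖) atTop (𝓝 0) := SeqAlg.mk_eq_mk.1 hb
  filter_upwards [h1.eventually_lt_const (half_pos (sub_pos.2 h))] with n hn
  have h2 : ‖b n‖ ≤ ‖b‖ := lp.norm_apply_le_norm ENNReal.top_ne_zero b n
  have h3 := norm_sub_norm_le (a n) (b n)
  rw [norm_sub_rev] at h3
  linarith

/-- `A ⊆ A_∞` meets `E_∞` in `E`, for closed `E`. -/
theorem mem_range_of_seqIncl_mem_range (i : A →⋆ₙₐ[ℂ] B) (hi : Function.Injective i) {b : B}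
    (h : seqIncl B b ∈ Set.range (SeqAlg.map i)) : b ∈ Set.range i := by
  obtain ⟨q, hq⟩ := h
  obtain ⟨a, rfl⟩ := SeqAlg.mk_surjective A q
  rw [SeqAlg.map_mk, seqIncl_apply, SeqAlg.mk_eq_mk] at hq
  -- A lift of the preimage gives `i (a n) → b`, and the range of `i` is closed.
  refine (i.isClosed_range_of_injective hi).mem_of_tendsto (tendsto_iff_norm_sub_tendsto_zero.2 hq)
    (Eventually.of_forall fun n => ⟨a n, rfl⟩)

end SeqAlgMap

/-! ### Hereditary subalgebras and ideals -/

/-- Restrictions of sequentially split `*`-homomorphisms: in the commutative square with sides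
`i`, `φ`, `f` and `j`, it suffices that `ψ` maps `F` into `E_∞`. -/
theorem SeqSplit.of_range_subset {A : Type u} {B : Type v} {E : Type w} {F : Type x}
    [NonUnitalCStarAlgebra A] [NonUnitalCStarAlgebra B] [NonUnitalCStarAlgebra E]
    [NonUnitalCStarAlgebra F] {φ : A →⋆ₙₐ[ℂ] B} (ψ : B →⋆ₙₐ[ℂ] SeqAlg A)
    (hψ : ψ.comp φ = seqIncl A) (i : E →⋆ₙₐ[ℂ] A) (hi : Function.Injective i) (j : F →⋆ₙₐ[ℂ] B)
    (f : E →⋆ₙₐ[ℂ] F) (hf : ∀ e, j (f e) = φ (i e))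
    (hr : ∀ y, ψ (j y) ∈ Set.range (SeqAlg.map i)) : SeqSplit f := by
  obtain ⟨g, hg⟩ := NonUnitalStarAlgHom.exists_comp_eq_of_range_subset (SeqAlg.map i)
    (SeqAlg.map_injective i hi) (ψ.comp j) hr
  refine ⟨g, NonUnitalStarAlgHom.ext fun e => SeqAlg.map_injective i hi ?_⟩
  rw [NonUnitalStarAlgHom.comp_apply, hg, NonUnitalStarAlgHom.comp_apply, hf,
    SeqAlg.map_seqIncl, ← hψ, NonUnitalStarAlgHom.comp_apply]

section Restrictions

variable {A : Type u} {B : Type v} [NonUnitalCStarAlgebra A] [NonUnitalCStarAlgebra B]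

theorem isPosElem_iff_nonneg [PartialOrder A] [StarOrderedRing A] {a : A} :
    IsPosElem a ↔ 0 ≤ a :=
  CStarAlgebra.nonneg_iff_eq_star_mul_self.symm

/-- Polarization of the form `(e, f) ↦ star e * a * f`, conjugate-linear in `e` and linear in `f`.
It reduces membership of `star e * a * f` in a subspace to the diagonal case `e = f`. -/
theorem four_smul_mul_mul_eq (e a f : A) :
    (4 : ℂ) • (star e * a * f) =
      star (e + f) * a * (e + f) - star (e - f) * a * (e - f)
      + Complex.I • (star (e - Complex.I • f) * a * (e - Complex.I • f))
      - Complex.I • (star (e + Complex.I • f) * a * (e + Complex.I • f)) := by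
  simp only [star_add, star_sub, star_smul, add_mul, mul_add, sub_mul, mul_sub, smul_add, smul_sub,
    smul_mul_assoc, mul_smul_comm, smul_smul, Complex.star_def, Complex.conj_I]
  have h : Complex.I * Complex.I = -1 := Complex.I_mul_I
  simp only [mul_neg, h, neg_smul, neg_neg, one_smul]
  module

/-- A hereditary subalgebra `E` satisfies `E A E ⊆ E`. -/
theorem IsHereditary.mul_mul_mem {E : NonUnitalStarSubalgebra ℂ A} (hE : IsHereditary E)
    {e f : A} (he : e ∈ E) (hf : f ∈ E) (a : A) : e * a * f ∈ E := by
  let _ : PartialOrder A := CStarAlgebra.spectralOrder A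
  have : StarOrderedRing A := CStarAlgebra.spectralOrderedRing A
  -- For `a ≥ 0` one has `0 ≤ e⋆ a e ≤ ‖a‖ e⋆ e`, and the right end lies in `E`. This is the only
  -- use of heredity.
  have hpos : ∀ a : A, 0 ≤ a → ∀ e ∈ E, star e * a * e ∈ E := by
    intro a ha e he
    refine hE ((‖a‖ : ℂ) • (star e * e)) (SMulMemClass.smul_mem _ (mul_mem (star_mem he) he)) _
      (isPosElem_iff_nonneg.2 (star_left_conjugate_nonneg ha e)) (isPosElem_iff_nonneg.2 ?_)
    rw [sub_nonneg, Complex.coe_smul]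
    exact CStarAlgebra.star_left_conjugate_le_norm_smul (IsSelfAdjoint.of_nonneg ha)
  have hpol : ∀ a : A, 0 ≤ a → ∀ e ∈ E, ∀ f ∈ E, star e * a * f ∈ E := by
    intro a ha e he f hf
    have h4 : (4 : ℂ) • (star e * a * f) ∈ E := by
      have hIf := SMulMemClass.smul_mem Complex.I hf
      rw [four_smul_mul_mul_eq]
      exact sub_mem (add_mem (sub_mem (hpos a ha _ (add_mem he hf)) (hpos a ha _ (sub_mem he hf)))
        (SMulMemClass.smul_mem _ (hpos a ha _ (sub_mem he hIf))))
        (SMulMemClass.smul_mem _ (hpos a ha _ (add_mem he hIf)))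
    have := SMulMemClass.smul_mem (4 : ℂ)⁻¹ h4
    rwa [smul_smul, inv_mul_cancel₀ (by norm_num), one_smul] at this
  -- The positive elements span `A`, so linearity removes the positivity assumption.
  have ha : a ∈ Submodule.span ℂ {a : A | 0 ≤ a} := by
    rw [CStarAlgebra.span_nonneg]; trivial
  induction ha using Submodule.span_induction with
  | mem a ha => simpa using hpol a ha (star e) (star_mem he) f hf
  | zero => simp
  | add x y _ _ hx hy => simp only [mul_add, add_mul]; exact add_mem hx hy
  | smul r x _ hx => simp only [mul_smul_comm, smul_mul_assoc]; exact SMulMemClass.smul_mem r hx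

/-- If `e A f ⊆ E`, then `e A_∞ f ⊆ E_∞`. -/
theorem mul_mul_mem_range_map {E : Type w} [NonUnitalCStarAlgebra E] (i : E →⋆ₙₐ[ℂ] A)
    (hi : Function.Injective i) {e f : A}
    (h : ∀ a : A, e * a * f ∈ Set.range i) (q : SeqAlg A) :
    seqIncl A e * q * seqIncl A f ∈ Set.range (SeqAlg.map i) := by
  obtain ⟨a, rfl⟩ := SeqAlg.mk_surjective A q
  choose g hg using fun n => h (a n)
  -- The entrywise preimages form a bounded sequence because `i` is isometric: their norms are those
  -- of `e (a n) f`.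
  refine ⟨SeqAlg.mk E (boundedSeq g ‖constSeq e * a * constSeq f‖ fun n => ?_), ?_⟩
  · rw [← NonUnitalStarAlgHom.norm_map i hi, hg]
    exact lp.norm_apply_le_norm ENNReal.top_ne_zero (constSeq e * a * constSeq f) n
  · rw [SeqAlg.map_mk, seqIncl_apply, seqIncl_apply, ← map_mul, ← map_mul]
    congr 1
    ext n
    exact hg n

/-- A `*`-homomorphism maps the closed linear span of `s` into every closed range that
contains the image of `s`. -/
theorem apply_mem_range_of_mem_closure_span {C : Type w} {E : Type x} [NonUnitalCStarAlgebra C]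
    [NonUnitalCStarAlgebra E] (ψ : B →⋆ₙₐ[ℂ] C) (i : E →⋆ₙₐ[ℂ] C) (hi : Function.Injective i)
    {s : Set B} (hs : ∀ y ∈ s, ψ y ∈ Set.range i) {y : B}
    (hy : y ∈ closure (Submodule.span ℂ s : Set B)) : ψ y ∈ Set.range i := by
  -- The preimage under `ψ` of a closed range is closed, so only the algebraic span has to be
  -- checked.
  have hcl := (i.isClosed_range_of_injective hi).preimage ψ.continuous_of_cstar
  refine closure_minimal (fun z hz => ?_) hcl hy
  change ψ z ∈ Set.range i
  induction hz using Submodule.span_induction with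
  | mem z hz => exact hs z hz
  | zero => exact ⟨0, by simp⟩
  | add y z _ _ hy hz =>
    obtain ⟨y', hy'⟩ := hy
    obtain ⟨z', hz'⟩ := hz
    exact ⟨y' + z', by simp [hy', hz']⟩
  | smul r y _ hy =>
    obtain ⟨y', hy'⟩ := hy
    exact ⟨r • y', by simp [hy']⟩

/-- The given splitting already works: it sends `φ(e) b φ(e')` to `e ψ(b) e'`, which lies in `E_∞`
since `e A e' ⊆ E`. -/
theorem SeqSplit.hereditaryRestrict {φ : A →⋆ₙₐ[ℂ] B} (hφ : SeqSplit φ)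
    (E : NonUnitalStarSubalgebra ℂ A) [IsClosed (E : Set A)] (hE : IsHereditary E) :
    SeqSplit (hereditaryRestrict φ E) := by
  obtain ⟨ψ, hψ⟩ := hφ
  have hψ' : ∀ a, ψ (φ a) = seqIncl A a := fun a => DFunLike.congr_fun hψ a
  let i : E →⋆ₙₐ[ℂ] A := NonUnitalStarSubalgebraClass.subtype E
  have hi : Function.Injective i := Subtype.val_injective
  refine SeqSplit.of_range_subset ψ hψ i hi
    (NonUnitalStarSubalgebraClass.subtype (hereditaryImage φ E)) _ (fun e => rfl) fun y => ?_
  refine apply_mem_range_of_mem_closure_span ψ (SeqAlg.map i) (SeqAlg.map_injective i hi) ?_ y.2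
  rintro _ ⟨e, he, b, e', he', rfl⟩
  rw [map_mul, map_mul, hψ', hψ']
  exact mul_mul_mem_range_map i hi (fun a => ⟨⟨_, hE.mul_mul_mem he he' a⟩, rfl⟩) (ψ b)

/-- A splitting `ψ` maps the closed ideal generated by `φ(J)` into `J_∞`. -/
theorem apply_mem_range_of_mem_map {φ : A →⋆ₙₐ[ℂ] B} {ψ : B →⋆ₙₐ[ℂ] SeqAlg A}
    (hψ : ψ.comp φ = seqIncl A) (J : ClosedIdeal A) {b : B} (hb : b ∈ J.map φ) :
    ψ b ∈ Set.range (SeqAlg.map J.subtype) := by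
  refine apply_mem_range_of_mem_closure_span ψ (SeqAlg.map J.subtype)
    (SeqAlg.map_injective _ J.subtype_injective) ?_ hb
  rintro _ ⟨b, j, hj, b', rfl⟩
  obtain ⟨p, hp⟩ := SeqAlg.mk_surjective A (ψ b)
  obtain ⟨r, hr⟩ := SeqAlg.mk_surjective A (ψ b')
  have hψ' : ψ (φ j) = seqIncl A j := DFunLike.congr_fun hψ j
  rw [map_mul, map_mul, hψ', ← hp, ← hr, seqIncl_apply, ← map_mul, ← map_mul, Set.mem_range]
  -- With `p` and `r` lifting `ψ b` and `ψ b'`, every entry `p n * j * r n` lies in `J`, so the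
  -- product is the class of a bounded sequence in `J`.
  refine ⟨SeqAlg.mk J (boundedSeq (A := J) (fun n => ⟨p n * j * r n,
    J.mul_mem_right _ (J.mul_mem_left _ hj)⟩) ‖p * constSeq j * r‖ fun n => ?_), ?_⟩
  · exact lp.norm_apply_le_norm ENNReal.top_ne_zero (p * constSeq j * r) n
  · rfl

theorem SeqSplit.idealRestrict {φ : A →⋆ₙₐ[ℂ] B} (hφ : SeqSplit φ) (J : ClosedIdeal A) :
    SeqSplit (J.restrict φ) := by
  obtain ⟨ψ, hψ⟩ := hφ
  exact SeqSplit.of_range_subset ψ hψ J.subtype J.subtype_injective (J.map φ).subtype _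
    (fun e => rfl) fun y => apply_mem_range_of_mem_map hψ J y.2

/-- Following `ψ` by `A_∞ → (A/J)_∞` kills the ideal generated by `φ(J)`, since `ψ` maps it into
`J_∞` and sequences in `J` become zero entrywise. The composite thus descends to the quotient of
`B`. -/
theorem SeqSplit.quotientMap {φ : A →⋆ₙₐ[ℂ] B} (hφ : SeqSplit φ) (J : ClosedIdeal A) :
    SeqSplit (J.quotientMap φ) := by
  obtain ⟨ψ, hψ⟩ := hφ
  let π := ClosedIdeal.Quotient.mk J
  refine ⟨ClosedIdeal.Quotient.lift (J.map φ) ((SeqAlg.map π).comp ψ) fun b hb => ?_, ?_⟩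
  · obtain ⟨q, hq⟩ := apply_mem_range_of_mem_map hψ J hb
    obtain ⟨j, rfl⟩ := SeqAlg.mk_surjective J q
    rw [NonUnitalStarAlgHom.comp_apply, ← hq, SeqAlg.map_mk, SeqAlg.map_mk, SeqAlg.mk_eq_zero]
    have h0 : ∀ n, π (j n : A) = 0 := fun n => (ClosedIdeal.Quotient.mk_eq_zero J).2 (j n).2
    refine tendsto_const_nhds.congr fun n => ?_
    rw [boundedSeqMap_apply, boundedSeqMap_apply]
    exact (norm_eq_zero.2 (h0 n)).symm
  · ext q
    obtain ⟨a, rfl⟩ := ClosedIdeal.Quotient.mk_surjective J q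
    have hψ' : ψ (φ a) = seqIncl A a := DFunLike.congr_fun hψ a
    change SeqAlg.map π (ψ (φ a)) = seqIncl _ (π a)
    rw [hψ', SeqAlg.map_seqIncl]

/-- An ideal is recovered from its image: if `φ a` lies in the ideal generated by `φ(K)`, then the
constant sequence `a` lies in `K_∞`, which forces `a ∈ K`. -/
theorem SeqSplit.idealMap_injective {φ : A →⋆ₙₐ[ℂ] B} (hφ : SeqSplit φ) :
    Function.Injective (ClosedIdeal.map φ) := by
  obtain ⟨ψ, hψ⟩ := hφ
  have key : ∀ J K : ClosedIdeal A, J.map φ = K.map φ → ∀ a ∈ J, a ∈ K := by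
    intro J K h a ha
    have h1 := J.apply_mem_map φ a ha
    rw [h] at h1
    have h2 := apply_mem_range_of_mem_map hψ K h1
    rw [show ψ (φ a) = seqIncl A a from DFunLike.congr_fun hψ a] at h2
    obtain ⟨k, rfl⟩ := mem_range_of_seqIncl_mem_range K.subtype K.subtype_injective h2
    exact k.2
  exact fun J K h => SetLike.ext fun a => ⟨key J K h a, key K J h.symm a⟩

end Restrictions

/-! ### Maximal tensor products -/

namespace MaxTensor

/-! ### Universal property of the maximal tensor product -/

section Universal

variable {A : Type u} {C : Type v} {E : Type w} [NonUnitalCStarAlgebra A]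
  [NonUnitalCStarAlgebra C] [NonUnitalCStarAlgebra E]

variable (A C) in
/-- The canonical `*`-homomorphism from the algebraic to the maximal tensor product. -/
def ofHom : A ⊗[ℂ] C →⋆ₙₐ[ℂ] MaxTensor A C where
  toFun := of
  map_smul' c t := CStarSeminorm.Completion.of_smul _ c t
  map_zero' := CStarSeminorm.Completion.of_zero _
  map_add' s t := CStarSeminorm.Completion.of_add _ s t
  map_mul' s t := CStarSeminorm.Completion.of_mul _ s t
  map_star' t := CStarSeminorm.Completion.of_star _ t

theorem ofHom_apply (t : A ⊗[ℂ] C) : ofHom A C t = of t := rfl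

variable (A C) in
theorem denseRange_ofHom : DenseRange (ofHom A C) := CStarSeminorm.Completion.denseRange_of _

/-- This estimate keeps entrywise tensor products of bounded sequences bounded, and null if one
factor is null. -/
theorem norm_ofHom_tmul_le (a : A) (c : C) : ‖ofHom A C (a ⊗ₜ c)‖ ≤ ‖a‖ * ‖c‖ :=
  (CStarSeminorm.Completion.norm_of _ _).trans_le ((maxTensorNorm A C).tmul_le a c)

/-- Two `*`-homomorphisms that agree on elementary tensors are equal. -/
theorem hom_ext {f g : MaxTensor A C →⋆ₙₐ[ℂ] E}
    (h : ∀ a c, f (ofHom A C (a ⊗ₜ c)) = g (ofHom A C (a ⊗ₜ c))) : f = g := by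
  refine DFunLike.coe_injective
    ((denseRange_ofHom A C).equalizer f.continuous_of_cstar g.continuous_of_cstar ?_)
  funext t
  change f (ofHom A C t) = g (ofHom A C t)
  induction t with
  | zero => simp
  | tmul a c => exact h a c
  | add s t hs ht => simp only [map_add, hs, ht]

/-- The C⋆-seminorm `t ↦ ‖f t‖`. -/
def normSeminorm (f : A ⊗[ℂ] C →⋆ₙₐ[ℂ] E) : CStarSeminorm (A ⊗[ℂ] C) where
  toFun t := ‖f t‖
  map_zero' := by simp
  add_le' s t := by rw [map_add]; exact norm_add_le _ _
  neg' t := by rw [map_neg, norm_neg]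
  smul' c t := by rw [map_smul, norm_smul]
  mul_le' s t := by rw [map_mul]; exact norm_mul_le _ _
  star_mul_self' t := by rw [map_mul, map_star, CStarRing.norm_star_mul_self]

/-- The universal property of the maximal tensor product. -/
theorem exists_lift (f : A ⊗[ℂ] C →⋆ₙₐ[ℂ] E) :
    ∃ g : MaxTensor A C →⋆ₙₐ[ℂ] E, ∀ t, g (ofHom A C t) = f t := by
  -- The pullback of the norm of `E` along `f` is one of the seminorms in the supremum, so `f` is
  -- contractive and extends to the completion. The algebraic laws then follow by density.
  have hf : ∀ t : A ⊗[ℂ] C, ‖f t‖ ≤ maxTensorNorm A C t := le_maxTensorNorm A C (normSeminorm f)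
  let F : (maxTensorNorm A C).Carrier →L[ℂ] E :=
    let F₀ : (maxTensorNorm A C).Carrier →ₗ[ℂ] E :=
      { toFun := fun t => f t, map_add' := map_add f, map_smul' := map_smul f }
    F₀.mkContinuous 1 fun t => by rw [one_mul]; exact hf t
  let G : MaxTensor A C → E := UniformSpace.Completion.extension F
  have hG : Continuous G := UniformSpace.Completion.continuous_extension
  have hGo : ∀ t, G (ofHom A C t) = f t :=
    UniformSpace.Completion.extension_coe (α := (maxTensorNorm A C).Carrier) F.uniformContinuous
  have hd := denseRange_ofHom A C
  refine ⟨{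
    toFun := G
    map_smul' := fun c a => hd.induction_on a
      (isClosed_eq (hG.comp (continuous_const_smul c)) (hG.const_smul c)) fun t => by
        simp only [← map_smul, hGo, MonoidHom.id_apply]
    map_zero' := by rw [← map_zero (ofHom A C), hGo, map_zero]
    map_add' := fun a b => hd.induction_on₂
      (isClosed_eq (by fun_prop) (by fun_prop))
      (fun s t => by simp only [← map_add, hGo]) a b
    map_mul' := fun a b => hd.induction_on₂
      (isClosed_eq (by fun_prop) (by fun_prop))
      (fun s t => by simp only [← map_mul, hGo]) a b
    map_star' := fun a => hd.induction_on a
      (isClosed_eq (by fun_prop) (by fun_prop)) fun t => by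
        simp only [← map_star, hGo] }, hGo⟩

/-- The `*`-homomorphism on the algebraic tensor product given by a multiplicative and
`*`-preserving bilinear map. -/
def algLift (β : A →ₗ[ℂ] C →ₗ[ℂ] E) (hmul : ∀ a a' c c', β (a * a') (c * c') = β a c * β a' c')
    (hstar : ∀ a c, β (star a) (star c) = star (β a c)) : A ⊗[ℂ] C →⋆ₙₐ[ℂ] E where
  toFun := TensorProduct.lift β
  map_smul' := map_smul (TensorProduct.lift β)
  map_zero' := map_zero _
  map_add' := map_add _
  map_mul' s t := by
    induction s with
    | zero => simp
    | add s s' hs hs' => simp only [add_mul, map_add, hs, hs']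
    | tmul a c =>
      induction t with
      | zero => simp
      | add t t' ht ht' => simp only [mul_add, map_add, ht, ht']
      | tmul a' c' => simp [hmul]
  map_star' t := by
    induction t with
    | zero => simp
    | add t t' ht ht' => simp only [star_add, map_add, ht, ht']
    | tmul a c => simp [hstar]

end Universal

/-! ### Tensor products of sequence algebras -/

section SeqAlg

variable {A : Type u} {C : Type v} [NonUnitalCStarAlgebra A] [NonUnitalCStarAlgebra C]

/-- The sequence `(aₙ ⊗ cₙ)ₙ`. -/
def tensorSeq (a : lp (fun _ : ℕ => A) ∞) (c : lp (fun _ : ℕ => C) ∞) :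
    lp (fun _ : ℕ => MaxTensor A C) ∞ :=
  boundedSeq (fun n => ofHom A C (a n ⊗ₜ c n)) (‖a‖ * ‖c‖) fun n =>
    (norm_ofHom_tmul_le _ _).trans <| mul_le_mul
      (lp.norm_apply_le_norm ENNReal.top_ne_zero a n)
      (lp.norm_apply_le_norm ENNReal.top_ne_zero c n) (norm_nonneg _) (norm_nonneg _)

theorem tensorSeq_apply (a : lp (fun _ : ℕ => A) ∞) (c : lp (fun _ : ℕ => C) ∞) (n : ℕ) :
    tensorSeq a c n = ofHom A C (a n ⊗ₜ c n) := rfl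

/-- Write `a ⊗ c - a' ⊗ c' = (a - a') ⊗ c + a' ⊗ (c - c')`. In each term one factor is null and the
other bounded. -/
theorem mk_tensorSeq_congr {a a' : lp (fun _ : ℕ => A) ∞} {c c' : lp (fun _ : ℕ => C) ∞}
    (ha : SeqAlg.mk A a = SeqAlg.mk A a') (hc : SeqAlg.mk C c = SeqAlg.mk C c') :
    SeqAlg.mk _ (tensorSeq a c) = SeqAlg.mk _ (tensorSeq a' c') := by
  rw [SeqAlg.mk_eq_mk] at ha hc ⊢
  refine squeeze_zero (fun _ => norm_nonneg _) (fun n => ?_)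
    (by simpa using (ha.mul_const ‖c‖).add (hc.const_mul ‖a'‖))
  have h : tensorSeq a c n - tensorSeq a' c' n =
      ofHom A C ((a n - a' n) ⊗ₜ c n) + ofHom A C (a' n ⊗ₜ (c n - c' n)) := by
    rw [tensorSeq_apply, tensorSeq_apply, ← map_sub, ← map_add, TensorProduct.sub_tmul,
      TensorProduct.tmul_sub]
    congr 1
    abel
  rw [h]
  refine (norm_add_le _ _).trans (add_le_add ((norm_ofHom_tmul_le _ _).trans ?_)
    ((norm_ofHom_tmul_le _ _).trans ?_))
  · gcongr; exact lp.norm_apply_le_norm ENNReal.top_ne_zero c n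
  · gcongr; exact lp.norm_apply_le_norm ENNReal.top_ne_zero _ n

/-- The canonical `*`-homomorphism `A_∞ ⊗ C_∞ → (A ⊗ C)_∞`. -/
theorem exists_tensor_seqAlg_hom :
    ∃ g : MaxTensor (SeqAlg A) (SeqAlg C) →⋆ₙₐ[ℂ] SeqAlg (MaxTensor A C), ∀ a c,
      g (ofHom _ _ (SeqAlg.mk A a ⊗ₜ SeqAlg.mk C c)) = SeqAlg.mk _ (tensorSeq a c) := by
  -- Arbitrary set-theoretic lifts define the pairing. By `hβ₀` it can be computed with any
  -- representatives, so bilinearity, multiplicativity and compatibility with `star` hold entrywise.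
  choose sA hA using SeqAlg.mk_surjective A
  choose sC hC using SeqAlg.mk_surjective C
  let β₀ : SeqAlg A → SeqAlg C → SeqAlg (MaxTensor A C) := fun q r =>
    SeqAlg.mk _ (tensorSeq (sA q) (sC r))
  have hβ₀ : ∀ a c, β₀ (SeqAlg.mk A a) (SeqAlg.mk C c) = SeqAlg.mk _ (tensorSeq a c) :=
    fun a c => mk_tensorSeq_congr (hA _) (hC _)
  let β : SeqAlg A →ₗ[ℂ] SeqAlg C →ₗ[ℂ] SeqAlg (MaxTensor A C) := LinearMap.mk₂ ℂ β₀
    (fun q q' r => by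
      obtain ⟨a, rfl⟩ := SeqAlg.mk_surjective A q
      obtain ⟨a', rfl⟩ := SeqAlg.mk_surjective A q'
      obtain ⟨c, rfl⟩ := SeqAlg.mk_surjective C r
      rw [← map_add, hβ₀, hβ₀, hβ₀, ← map_add]
      congr 1; ext n
      simp [tensorSeq_apply, TensorProduct.add_tmul])
    (fun z q r => by
      obtain ⟨a, rfl⟩ := SeqAlg.mk_surjective A q
      obtain ⟨c, rfl⟩ := SeqAlg.mk_surjective C r
      rw [← map_smul, hβ₀, hβ₀, ← map_smul]
      congr 1; ext n
      simp only [tensorSeq_apply, lp.coeFn_smul, Pi.smul_apply, ← TensorProduct.smul_tmul',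
        map_smul])
    (fun q r r' => by
      obtain ⟨a, rfl⟩ := SeqAlg.mk_surjective A q
      obtain ⟨c, rfl⟩ := SeqAlg.mk_surjective C r
      obtain ⟨c', rfl⟩ := SeqAlg.mk_surjective C r'
      rw [← map_add, hβ₀, hβ₀, hβ₀, ← map_add]
      congr 1; ext n
      simp [tensorSeq_apply, TensorProduct.tmul_add])
    (fun z q r => by
      obtain ⟨a, rfl⟩ := SeqAlg.mk_surjective A q
      obtain ⟨c, rfl⟩ := SeqAlg.mk_surjective C r
      rw [← map_smul, hβ₀, hβ₀, ← map_smul]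
      congr 1; ext n
      simp only [tensorSeq_apply, lp.coeFn_smul, Pi.smul_apply, TensorProduct.tmul_smul,
        map_smul])
  obtain ⟨g, hg⟩ := exists_lift (algLift β
    (fun q q' r r' => by
      obtain ⟨a, rfl⟩ := SeqAlg.mk_surjective A q
      obtain ⟨a', rfl⟩ := SeqAlg.mk_surjective A q'
      obtain ⟨c, rfl⟩ := SeqAlg.mk_surjective C r
      obtain ⟨c', rfl⟩ := SeqAlg.mk_surjective C r'
      simp only [β, LinearMap.mk₂_apply]
      rw [← map_mul, ← map_mul, hβ₀, hβ₀, hβ₀, ← map_mul]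
      congr 1; ext n
      simp only [tensorSeq_apply, lp.infty_coeFn_mul, Pi.mul_apply, ← map_mul,
        Algebra.TensorProduct.tmul_mul_tmul])
    (fun q r => by
      obtain ⟨a, rfl⟩ := SeqAlg.mk_surjective A q
      obtain ⟨c, rfl⟩ := SeqAlg.mk_surjective C r
      simp only [β, LinearMap.mk₂_apply]
      rw [← map_star, ← map_star, hβ₀, hβ₀, ← map_star]
      congr 1; ext n
      simp only [tensorSeq_apply, lp.star_apply, ← map_star, TensorProduct.star_tmul]))
  exact ⟨g, fun a c => (hg _).trans (hβ₀ a c)⟩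

end SeqAlg

end MaxTensor

/-- The splitting is the composite `B ⊗ D → A_∞ ⊗ C_∞ → (A ⊗ C)_∞`. On `φ a ⊗ ρ c` it gives the
constant sequence `a ⊗ c`, and elementary tensors determine a `*`-homomorphism. -/
theorem SeqSplit.maxTensorMap {A : Type u} {B : Type v} {C : Type w} {D : Type x}
    [NonUnitalCStarAlgebra A] [NonUnitalCStarAlgebra B] [NonUnitalCStarAlgebra C]
    [NonUnitalCStarAlgebra D] {φ : A →⋆ₙₐ[ℂ] B} (hφ : SeqSplit φ) {ρ : C →⋆ₙₐ[ℂ] D}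
    (hρ : SeqSplit ρ) : SeqSplit (MaxTensor.map φ ρ) := by
  obtain ⟨ψ, hψ⟩ := hφ
  obtain ⟨σ, hσ⟩ := hρ
  obtain ⟨g, hg⟩ := MaxTensor.exists_tensor_seqAlg_hom (A := A) (C := C)
  refine ⟨g.comp (MaxTensor.map ψ σ), MaxTensor.hom_ext fun a c => ?_⟩
  have h1 : ψ (φ a) = seqIncl A a := DFunLike.congr_fun hψ a
  have h2 : σ (ρ c) = seqIncl C c := DFunLike.congr_fun hσ c
  rw [NonUnitalStarAlgHom.comp_apply, NonUnitalStarAlgHom.comp_apply, MaxTensor.ofHom_apply,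
    MaxTensor.map_of_tmul, MaxTensor.map_of_tmul, h1, h2]
  exact hg (constSeq a) (constSeq c)

/-- It allows tensoring `φ` with a fixed algebra: the compact operators, `C₀(ℝ)` or `C₀(Wₙ)`. -/
theorem SeqSplit.id (A : Type u) [NonUnitalCStarAlgebra A] :
    SeqSplit (NonUnitalStarAlgHom.id ℂ A) := ⟨seqIncl A, rfl⟩

/-! ### The Cuntz semigroup -/

/-- Sequentially split `*`-homomorphisms reflect Cuntz subequivalence. -/
theorem SeqSplit.cuntzLE {A : Type u} {B : Type v} [NonUnitalCStarAlgebra A]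
    [NonUnitalCStarAlgebra B] {φ : A →⋆ₙₐ[ℂ] B} (hφ : SeqSplit φ) {a b : A}
    (h : CuntzLE (φ a) (φ b)) : CuntzLE a b := by
  obtain ⟨ψ, hψ⟩ := hφ
  have hψ' : ∀ a, ψ (φ a) = seqIncl A a := fun a => DFunLike.congr_fun hψ a
  intro ε hε
  obtain ⟨y, hy⟩ := h ε hε
  obtain ⟨z, hz⟩ := SeqAlg.mk_surjective A (ψ y)
  -- Since `ψ` is contractive and sends `φ a`, `φ b` to constants, the estimate for `y` holds in
  -- `A_∞` for `ψ y`. Entries of the lift `z` far enough out satisfy it in `A`.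
  have h1 := (NonUnitalStarAlgHom.norm_apply_le ψ _).trans_lt hy
  rw [map_sub, map_mul, map_mul, map_star, hψ', hψ', ← hz, seqIncl_apply, seqIncl_apply,
    ← map_star, ← map_mul, ← map_mul, ← map_sub] at h1
  obtain ⟨n, hn⟩ := (SeqAlg.eventually_norm_lt h1).exists
  exact ⟨z n, hn⟩

/-- The order on `Cu` is Cuntz subequivalence in the stabilisation, where `φ ⊗ id` is again
sequentially split. -/
theorem SeqSplit.cuMap_le_iff {A : Type u} {B : Type v} [NonUnitalCStarAlgebra A]
    [NonUnitalCStarAlgebra B] {φ : A →⋆ₙₐ[ℂ] B} (hφ : SeqSplit φ) (a b : Cu A) :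
    Cu.map φ a ≤ Cu.map φ b ↔ a ≤ b := by
  refine ⟨?_, fun h => (Cu.map φ).monotone h⟩
  induction a using Quotient.inductionOn with | _ a
  induction b using Quotient.inductionOn with | _ b
  exact fun h => (hφ.maxTensorMap (SeqSplit.id CompactOp)).cuntzLE h

/-! ### Tracial states -/

section Traces

variable {A : Type u} [NonUnitalCStarAlgebra A]

/-- A bounded functional takes a limit along the hyperfilter on every bounded sequence. -/
theorem tendsto_hyperfilter_limUnder (τ : A →L[ℂ] ℂ) (a : lp (fun _ : ℕ => A) ∞) :
    Tendsto (fun n => τ (a n)) (hyperfilter ℕ) (𝓝 (limUnder (hyperfilter ℕ : Filter ℕ)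
      fun n => τ (a n))) := by
  have hmem : ∀ n, τ (a n) ∈ Metric.closedBall (0 : ℂ) (‖τ‖ * ‖a‖) := fun n => by
    rw [mem_closedBall_zero_iff]
    exact (τ.le_opNorm _).trans (mul_le_mul_of_nonneg_left
      (lp.norm_apply_le_norm ENNReal.top_ne_zero a n) (norm_nonneg _))
  -- The values stay in a compact disk, where every ultrafilter converges.
  obtain ⟨z, -, hz⟩ := (isCompact_closedBall (0 : ℂ) (‖τ‖ * ‖a‖)).ultrafilter_le_nhds
    ((hyperfilter ℕ).map fun n => τ (a n)) (by
      rw [le_principal_iff, Ultrafilter.coe_map, Filter.mem_map]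
      exact Filter.univ_mem' hmem)
  exact tendsto_nhds_limUnder ⟨z, hz⟩

/-- The functional on `A_∞` given by limits of `τ(aₙ)` along the hyperfilter. -/
theorem exists_limit_functional (τ : A →L[ℂ] ℂ) :
    ∃ T : SeqAlg A →L[ℂ] ℂ, ‖T‖ ≤ ‖τ‖ ∧ ∀ a : lp (fun _ : ℕ => A) ∞,
      Tendsto (fun n => τ (a n)) (hyperfilter ℕ) (𝓝 (T (SeqAlg.mk A a))) := by
  choose s hs using SeqAlg.mk_surjective A
  let T₀ : SeqAlg A → ℂ := fun q => limUnder (hyperfilter ℕ : Filter ℕ) fun n => τ (s q n)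
  have hT₀ : ∀ a : lp (fun _ : ℕ => A) ∞,
      Tendsto (fun n => τ (a n)) (hyperfilter ℕ) (𝓝 (T₀ (SeqAlg.mk A a))) := fun a => by
    -- The limit does not depend on the lift: two lifts differ by a null sequence, and the
    -- hyperfilter refines `atTop`.
    have h1 := (tendsto_zero_iff_norm_tendsto_zero.2
      (SeqAlg.mk_eq_mk.1 (hs (SeqAlg.mk A a)))).mono_left Nat.hyperfilter_le_atTop
    have h2 := (tendsto_hyperfilter_limUnder τ (s (SeqAlg.mk A a))).sub
      ((τ.continuous.tendsto 0).comp h1)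
    rw [map_zero, sub_zero] at h2
    refine h2.congr fun n => ?_
    simp
  have hadd : ∀ q r, T₀ (q + r) = T₀ q + T₀ r := fun q r => by
    obtain ⟨a, rfl⟩ := SeqAlg.mk_surjective A q
    obtain ⟨b, rfl⟩ := SeqAlg.mk_surjective A r
    rw [← map_add]
    refine tendsto_nhds_unique (hT₀ (a + b)) (((hT₀ a).add (hT₀ b)).congr fun n => ?_)
    simp
  have hsmul : ∀ (c : ℂ) q, T₀ (c • q) = c • T₀ q := fun c q => by
    obtain ⟨a, rfl⟩ := SeqAlg.mk_surjective A q
    rw [← map_smul]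
    refine tendsto_nhds_unique (hT₀ (c • a)) (((hT₀ a).const_smul c).congr fun n => ?_)
    simp
  have hbound : ∀ q, ‖T₀ q‖ ≤ ‖τ‖ * ‖q‖ := fun q => by
    -- The quotient norm is an infimum over lifts, so the bound is obtained with an error `ε` that
    -- then tends to zero.
    have h : ∀ ε : ℝ, 0 < ε → ‖T₀ q‖ ≤ ‖τ‖ * (‖q‖ + ε) := fun ε hε => by
      obtain ⟨a, rfl, ha⟩ := ClosedIdeal.Quotient.exists_norm_lt (nullSequences A) q hε
      refine le_of_tendsto (hT₀ a).norm (Eventually.of_forall fun n => (τ.le_opNorm _).trans ?_)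
      gcongr
      exact (lp.norm_apply_le_norm ENNReal.top_ne_zero a n).trans ha.le
    have hc : Tendsto (fun ε : ℝ => ‖τ‖ * (‖q‖ + ε)) (𝓝[>] 0) (𝓝 (‖τ‖ * (‖q‖ + 0))) :=
      (Continuous.tendsto (by fun_prop) 0).mono_left nhdsWithin_le_nhds
    rw [add_zero] at hc
    exact ge_of_tendsto hc (eventually_nhdsWithin_of_forall fun ε hε => h ε hε)
  exact ⟨LinearMap.mkContinuous { toFun := T₀, map_add' := hadd, map_smul' := hsmul } ‖τ‖ hbound,
    LinearMap.mkContinuous_norm_le _ (norm_nonneg _) _, hT₀⟩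

/-- The trace on `B` is `b ↦ lim τ(aₙ)` along the hyperfilter, where `(aₙ)` lifts `ψ b`. Positivity
and the trace identity hold entrywise and pass to the limit. -/
theorem SeqSplit.exists_tracialState {B : Type v} [NonUnitalCStarAlgebra B] {φ : A →⋆ₙₐ[ℂ] B}
    (hφ : SeqSplit φ) (τ : TracialState A) : ∃ τ' : TracialState B, ∀ a : A, τ' (φ a) = τ a := by
  obtain ⟨ψ, hψ⟩ := hφ
  obtain ⟨T, hTn, hT⟩ := exists_limit_functional τ.toFun
  let Ψ : B →L[ℂ] SeqAlg A := LinearMap.mkContinuous (ψ : B →ₗ[ℂ] SeqAlg A) 1 fun b => by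
    rw [one_mul]; exact NonUnitalStarAlgHom.norm_apply_le ψ b
  let σ : B →L[ℂ] ℂ := T.comp Ψ
  have hσ : ∀ b, σ b = T (ψ b) := fun b => rfl
  have hσφ : ∀ a, σ (φ a) = τ a := fun a => by
    have h1 : ψ (φ a) = SeqAlg.mk A (constSeq a) := DFunLike.congr_fun hψ a
    rw [hσ, h1]
    exact tendsto_nhds_unique (hT (constSeq a)) tendsto_const_nhds
  refine ⟨⟨σ, fun b => ?_, le_antisymm ?_ ?_, fun b c => ?_⟩, hσφ⟩
  · obtain ⟨a, ha⟩ := SeqAlg.mk_surjective A (ψ b)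
    rw [hσ, map_mul, map_star, ← ha, ← map_star, ← map_mul]
    have h := hT (star a * a)
    refine ⟨ge_of_tendsto ((Complex.continuous_re.tendsto _).comp h)
      (Eventually.of_forall fun n => (τ.nonneg' (a n)).1), ?_⟩
    exact tendsto_nhds_unique ((Complex.continuous_im.tendsto _).comp h)
      (tendsto_const_nhds.congr fun n => (τ.nonneg' (a n)).2.symm)
  · refine σ.opNorm_le_bound zero_le_one fun b => ?_
    rw [hσ]
    refine (T.le_opNorm _).trans ?_
    exact mul_le_mul (hTn.trans τ.norm_eq_one'.le) (NonUnitalStarAlgHom.norm_apply_le ψ b)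
      (norm_nonneg _) zero_le_one
  -- The norm does not drop below one: `σ ∘ φ = τ` has norm one and `φ` is contractive.
  · rw [← τ.norm_eq_one']
    refine τ.toFun.opNorm_le_bound (norm_nonneg _) fun a => ?_
    rw [← hσφ]
    exact (σ.le_opNorm _).trans
      (mul_le_mul_of_nonneg_left (NonUnitalStarAlgHom.norm_apply_le φ a) (norm_nonneg _))
  · obtain ⟨p, hp⟩ := SeqAlg.mk_surjective A (ψ b)
    obtain ⟨q, hq⟩ := SeqAlg.mk_surjective A (ψ c)
    rw [hσ, hσ, map_mul ψ, map_mul ψ, ← hp, ← hq, ← map_mul, ← map_mul]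
    exact tendsto_nhds_unique (hT (p * q)) ((hT (q * p)).congr fun n => τ.trace' (q n) (p n))

end Traces

/-! ### K-theory -/

/-! ### Perturbation of approximate Murray–von Neumann equivalences -/

section Stability

open Matrix

/-- A self-adjoint element at distance less than one from the unit has an inverse square root. -/
theorem exists_inv_sqrt {M : Type u} [CStarAlgebra M] {a : M} (ha : IsSelfAdjoint a)
    (hn : ‖1 - a‖ < 1) :
    ∃ h : M, IsSelfAdjoint h ∧ h * h * a = 1 ∧ ∀ b, Commute a b → Commute h b := by
  -- The spectrum of `1 - a` lies in `(-1, 1)`, hence that of `a` in the positive reals, and `t ↦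
  -- t^(-1/2)` is continuous there.
  have hpos : ∀ t ∈ spectrum ℝ a, 0 < t := by
    intro t ht
    rcases subsingleton_or_nontrivial M with hM | hM
    · simp [spectrum.of_subsingleton] at ht
    · have h1 : 1 - t ∈ spectrum ℝ (1 - a) := by
        rw [← map_one (algebraMap ℝ M), ← spectrum.singleton_sub_eq]
        exact Set.sub_mem_sub rfl ht
      have h2 := spectrum.norm_le_norm_of_mem h1
      have h4 := (le_abs_self (1 - t)).trans_lt (h2.trans_lt hn)
      linarith
  have hc : ContinuousOn (fun t : ℝ => (√t)⁻¹) (spectrum ℝ a) :=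
    Real.continuous_sqrt.continuousOn.inv₀ fun t ht => (Real.sqrt_pos.2 (hpos t ht)).ne'
  refine ⟨cfc (fun t : ℝ => (√t)⁻¹) a, cfc_predicate _ _, ?_, fun b hb => hb.cfc_real _⟩
  -- Writing the bare factor `a` as a functional calculus too reduces the claim to a pointwise
  -- identity on the spectrum.
  nth_rw 3 [← cfc_id' ℝ a]
  rw [← cfc_mul _ _ a hc hc,
    ← cfc_mul (fun t => (√t)⁻¹ * (√t)⁻¹) (fun t => t) a (hc.mul hc) continuousOn_id,
    ← cfc_one ℝ a]
  refine cfc_congr fun t ht => ?_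
  have h := Real.sqrt_pos.2 (hpos t ht)
  have h' := Real.mul_self_sqrt (hpos t ht).le
  simp only [Pi.one_apply]
  field_simp
  nlinarith

variable {R : Type u} [CStarAlgebra R] [PartialOrder R] [StarOrderedRing R] {ι κ : Type}
  [Fintype ι] [Fintype κ]

/-- `CStarMatrix` carries the C⋆-norm on the same matrices, so the functional calculus is done there
and the result read back. -/
theorem exists_matrix_inv_sqrt [DecidableEq κ] {a : Matrix κ κ R} (ha : aᴴ = a)
    (hn : ‖CStarMatrix.ofMatrix (1 - a)‖ < 1) :
    ∃ h : Matrix κ κ R, hᴴ = h ∧ h * h * a = 1 ∧ ∀ b, a * b = b * a → h * b = b * h := by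
  obtain ⟨h, h1, h2, h3⟩ := exists_inv_sqrt (M := CStarMatrix κ κ R)
    (a := CStarMatrix.ofMatrix a) ha hn
  exact ⟨CStarMatrix.ofMatrix.symm h, h1, h2, fun b hb => h3 (CStarMatrix.ofMatrix b) hb⟩

/-- Projections `p`, `q` are equivalent as soon as there is `y ∈ p M q` with `y y⋆` close to `p`
and `y⋆ y` close to `q`. -/
theorem MvN.of_norm_lt {p : Matrix ι ι R} {q : Matrix κ κ R} (hp : IsStarProjection p)
    (hq : IsStarProjection q) {y : Matrix ι κ R} (hpy : p * y = y) (hyq : y * q = y)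
    (h₁ : ‖CStarMatrix.ofMatrix (y * yᴴ - p)‖ < 1)
    (h₂ : ‖CStarMatrix.ofMatrix (yᴴ * y - q)‖ < 1) : MvN p q := by
  classical
  have hp1 : p * p = p := hp.isIdempotentElem
  have hq1 : q * q = q := hq.isIdempotentElem
  have hp2 : pᴴ = p := hp.isSelfAdjoint
  have hq2 : qᴴ = q := hq.isSelfAdjoint
  have hyp : yᴴ * p = yᴴ := by
    have := congrArg conjTranspose hpy
    rwa [conjTranspose_mul, hp2] at this
  have hqy : q * yᴴ = yᴴ := by
    have := congrArg conjTranspose hyq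
    rwa [conjTranspose_mul, hq2] at this
  -- Adding `1 - e` turns an element close to the projection `e` into one close to the unit of the
  -- full matrix algebra, so it has an inverse square root there.
  have key : ∀ {μ : Type} [Fintype μ] [DecidableEq μ] (e b : Matrix μ μ R), eᴴ = e → bᴴ = b →
      ‖CStarMatrix.ofMatrix (b - e)‖ < 1 → ∃ h : Matrix μ μ R, hᴴ = h ∧ h * h * (b + (1 - e)) = 1 ∧
        ∀ c, (b + (1 - e)) * c = c * (b + (1 - e)) → h * c = c * h := by
    intro μ _ _ e b he hb hn
    refine exists_matrix_inv_sqrt (by simp [he, hb]) ?_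
    have : CStarMatrix.ofMatrix (1 - (b + (1 - e))) = -CStarMatrix.ofMatrix (b - e) := by
      rw [CStarMatrix.neg_of]; congr 1; abel
    rwa [this, norm_neg]
  obtain ⟨h, hh1, hh2, hh3⟩ := key q (yᴴ * y) hq2 (by simp) h₂
  obtain ⟨k, -, hk2, hk3⟩ := key p (y * yᴴ) hp2 (by simp) h₁
  have hxq : (yᴴ * y + (1 - q)) * q = yᴴ * y := by
    rw [add_mul, sub_mul, one_mul, hq1, sub_self, add_zero, Matrix.mul_assoc, hyq]
  have hqx : q * (yᴴ * y + (1 - q)) = yᴴ * y := by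
    rw [mul_add, mul_sub, mul_one, hq1, sub_self, add_zero, ← Matrix.mul_assoc, hqy]
  have hhq : h * q = q * h := hh3 q (hxq.trans hqx.symm)
  have hhx : h * (yᴴ * y + (1 - q)) = (yᴴ * y + (1 - q)) * h := hh3 _ rfl
  have hhy : h * h * (yᴴ * y) = q := by
    rw [← hxq, ← mul_assoc, hh2, one_mul]
  have hxh : (yᴴ * y) * h = h * (yᴴ * y) := by
    rw [← hxq, mul_assoc, ← hhq, ← mul_assoc, ← hhx, mul_assoc]
  -- The witness is the polar part of `y`, with `h = (y⋆y + 1 - q)^(-1/2)`. Since `h` commutes with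
  -- `y⋆y`, the product `(y h)⋆(y h) = h² y⋆y` is `q`.
  refine ⟨y * h, ?_, ?_⟩
  · have hu : (y * h * (y * h)ᴴ) * (y * yᴴ) = y * yᴴ := by
      calc (y * h * (y * h)ᴴ) * (y * yᴴ) = y * (h * h * (yᴴ * y)) * yᴴ := by
            rw [conjTranspose_mul, hh1]; simp only [Matrix.mul_assoc]
        _ = y * yᴴ := by rw [hhy, hyq]
    have hup : (y * h * (y * h)ᴴ) * p = y * h * (y * h)ᴴ := by
      rw [conjTranspose_mul, Matrix.mul_assoc, Matrix.mul_assoc hᴴ, hyp]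
    -- The other product is compared with `p`: both agree after right multiplication by `y y⋆ + 1 -
    -- p`, which `k * k` inverts. Commutation with `k` turns the left inverse into a right one.
    have hz : (y * yᴴ + (1 - p)) * (k * k) = 1 := by
      have hkz := hk3 _ rfl
      rw [← mul_assoc, ← hkz, mul_assoc, ← hkz, ← mul_assoc, hk2]
    have e1 : (y * h * (y * h)ᴴ) * (y * yᴴ + (1 - p)) = p * (y * yᴴ + (1 - p)) := by
      rw [mul_add, hu, mul_sub, mul_one, hup, sub_self, mul_add, mul_sub, mul_one, hp1, sub_self,
        ← Matrix.mul_assoc p, hpy]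
    have e2 := congrArg (· * (k * k)) e1
    simpa only [mul_assoc, hz, mul_one] using e2
  · rw [conjTranspose_mul, hh1]
    calc h * yᴴ * (y * h) = h * ((yᴴ * y) * h) := by simp only [Matrix.mul_assoc]
      _ = q := by rw [hxh, ← mul_assoc, hhy]

end Stability

/-! ### Reflecting Murray–von Neumann equivalence through sequence algebras -/

section Lifting

open Matrix

theorem Matrix.map_mul_nonUnital {l m n : Type} [Fintype m] {R : Type u} {S : Type v}
    [NonUnitalCStarAlgebra R] [NonUnitalCStarAlgebra S] (f : R →⋆ₙₐ[ℂ] S) (M : Matrix l m R)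
    (N : Matrix m n R) : (M * N).map f = M.map f * N.map f := by
  ext i j
  simp [Matrix.mul_apply, map_sum]

theorem Matrix.map_conjTranspose_nonUnital {m n : Type} {R : Type u} {S : Type v}
    [NonUnitalCStarAlgebra R] [NonUnitalCStarAlgebra S] (f : R →⋆ₙₐ[ℂ] S) (M : Matrix m n R) :
    (Mᴴ).map f = (M.map f)ᴴ := by
  ext i j
  simp [map_star]

section

variable (A : Type u) [NonUnitalCStarAlgebra A]

/-- The inclusion of `A` into `ℓ^∞(ℕ, A)` as constant sequences. -/
def constSeqHom : A →⋆ₙₐ[ℂ] lp (fun _ : ℕ => A) ∞ where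
  toFun := constSeq
  map_smul' _ _ := rfl
  map_zero' := rfl
  map_add' _ _ := rfl
  map_mul' _ _ := rfl
  map_star' _ := rfl

/-- Evaluation of bounded sequences at `n`. -/
def evalSeqHom (n : ℕ) : lp (fun _ : ℕ => A) ∞ →⋆ₙₐ[ℂ] A where
  toFun a := a n
  map_smul' _ _ := rfl
  map_zero' := rfl
  map_add' _ _ := rfl
  map_mul' _ _ := rfl
  map_star' _ := rfl

end

variable {R : Type u} {S : Type v} [CStarAlgebra R] [CStarAlgebra S] {ι κ : Type} [Fintype ι]
  [Fintype κ]

/-- Entrywise convergence implies convergence in norm. -/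
theorem tendsto_norm_matrix_eval [PartialOrder R] [StarOrderedRing R]
    {a : Matrix ι ι (lp (fun _ : ℕ => R) ∞)} {p : Matrix ι ι R}
    (h : a.map (SeqAlg.mk R) = p.map (seqIncl R)) :
    Tendsto (fun n => ‖CStarMatrix.ofMatrix (a.map (evalSeqHom R n) - p)‖) atTop (𝓝 0) := by
  have h0 : Tendsto (fun n => a.map (evalSeqHom R n) - p) atTop (𝓝 0) := by
    refine tendsto_pi_nhds.2 fun i => tendsto_pi_nhds.2 fun j => ?_
    have hij : SeqAlg.mk R (a i j) = SeqAlg.mk R (constSeq (p i j)) := congrFun (congrFun h i) j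
    exact tendsto_zero_iff_norm_tendsto_zero.2 (SeqAlg.mk_eq_mk.1 hij)
  -- The identification with `CStarMatrix` is continuous from the product topology, which turns
  -- entrywise limits into norm limits.
  have h1 := ((CStarMatrix.ofMatrixL (m := ι) (n := ι) (A := R)).continuous.tendsto 0).comp h0
  rw [map_zero] at h1
  exact tendsto_zero_iff_norm_tendsto_zero.1 h1

/-- If `f` is split by a `*`-homomorphism into the sequence algebra, then it reflects
Murray–von Neumann equivalence. -/
theorem MvN.of_map (f : R →⋆ₐ[ℂ] S) (g : S →⋆ₙₐ[ℂ] SeqAlg R) (hg : ∀ r, g (f r) = seqIncl R r)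
    {p : Matrix ι ι R} {q : Matrix κ κ R} (hp : IsStarProjection p) (hq : IsStarProjection q)
    (h : MvN (p.map f) (q.map f)) : MvN p q := by
  let _ : PartialOrder R := CStarAlgebra.spectralOrder R
  have : StarOrderedRing R := CStarAlgebra.spectralOrderedRing R
  have hp1 : p * p = p := hp.isIdempotentElem
  have hq1 : q * q = q := hq.isIdempotentElem
  have hp2 : pᴴ = p := hp.isSelfAdjoint
  have hq2 : qᴴ = q := hq.isSelfAdjoint
  obtain ⟨y, hy1, hy2⟩ := h
  choose s hs using SeqAlg.mk_surjective R
  -- The lift of `g(y)` is cut down by the constants `p` and `q`, so that every evaluation lies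
  -- exactly, not just approximately, in the corner between `p` and `q`.
  let z : Matrix ι κ (lp (fun _ : ℕ => R) ∞) :=
    p.map (constSeqHom R) * (y.map fun b => s (g b)) * q.map (constSeqHom R)
  have hgf : ∀ {μ : Type} (m : Matrix μ μ R), (m.map f).map g = m.map (seqIncl R) := by
    intro μ m; ext i j; exact hg _
  have hcomp : ∀ {μ : Type} (m : Matrix μ μ R),
      (m.map (constSeqHom R)).map (SeqAlg.mk R) = (m.map f).map g := fun m => by
    rw [hgf]; rfl
  have hzmk : z.map (SeqAlg.mk R) = (p.map f * y * q.map f).map g := by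
    have hys : (y.map fun b => s (g b)).map (SeqAlg.mk R) = y.map g := by ext i j; exact hs _
    simp only [z, Matrix.map_mul_nonUnital, hcomp, hys]
  have hpf : p.map f * p.map f = p.map f := by rw [← Matrix.map_mul, hp1]
  have hqf : q.map f * q.map f = q.map f := by rw [← Matrix.map_mul, hq1]
  have hpf2 : (p.map f)ᴴ = p.map f := by rw [← Matrix.conjTranspose_map _ (map_star f), hp2]
  have hqf2 : (q.map f)ᴴ = q.map f := by rw [← Matrix.conjTranspose_map _ (map_star f), hq2]
  -- The cut-down of `y` implements the same equivalence, because `y y⋆` and `y⋆ y` are the images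
  -- of `p` and `q`.
  have e1 : (p.map f * y * q.map f) * (p.map f * y * q.map f)ᴴ = p.map f := by
    calc _ = p.map f * (y * (q.map f * q.map f) * yᴴ) * p.map f := by
          simp only [conjTranspose_mul, hpf2, hqf2, Matrix.mul_assoc]
      _ = p.map f * ((y * yᴴ) * (y * yᴴ)) * p.map f := by
          rw [hqf, ← hy2]; simp only [Matrix.mul_assoc]
      _ = p.map f := by simp only [hy1, hpf]
  have e2 : (p.map f * y * q.map f)ᴴ * (p.map f * y * q.map f) = q.map f := by
    calc _ = q.map f * (yᴴ * (p.map f * p.map f) * y) * q.map f := by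
          simp only [conjTranspose_mul, hpf2, hqf2, Matrix.mul_assoc]
      _ = q.map f * ((yᴴ * y) * (yᴴ * y)) * q.map f := by
          rw [hpf, ← hy1]; simp only [Matrix.mul_assoc]
      _ = q.map f := by simp only [hy2, hqf]
  have t1 := tendsto_norm_matrix_eval (a := z * zᴴ) (p := p) (by
    rw [Matrix.map_mul_nonUnital, Matrix.map_conjTranspose_nonUnital, hzmk,
      ← Matrix.map_conjTranspose_nonUnital, ← Matrix.map_mul_nonUnital, e1, hgf])
  have t2 := tendsto_norm_matrix_eval (a := zᴴ * z) (p := q) (by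
    rw [Matrix.map_mul_nonUnital, Matrix.map_conjTranspose_nonUnital, hzmk,
      ← Matrix.map_conjTranspose_nonUnital, ← Matrix.map_mul_nonUnital, e2, hgf])
  -- A single index far enough out serves both estimates, and the threshold one is what
  -- `MvN.of_norm_lt` requires.
  obtain ⟨n, hn1, hn2⟩ :=
    ((t1.eventually_lt_const zero_lt_one).and (t2.eventually_lt_const zero_lt_one)).exists
  have hev : ∀ {μ : Type} (m : Matrix μ μ R),
      (m.map (constSeqHom R)).map (evalSeqHom R n) = m := fun m => rfl
  have hz : z.map (evalSeqHom R n) =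
      p * (y.map fun b => s (g b)).map (evalSeqHom R n) * q := by
    simp only [z, Matrix.map_mul_nonUnital, hev]
  rw [Matrix.map_mul_nonUnital, Matrix.map_conjTranspose_nonUnital] at hn1 hn2
  refine MvN.of_norm_lt hp hq (y := z.map (evalSeqHom R n)) ?_ ?_ hn1 hn2
  · rw [hz, ← Matrix.mul_assoc, ← Matrix.mul_assoc, hp1]
  · rw [hz, Matrix.mul_assoc, hq1]

end Lifting

/-! ### From projections to injectivity on K-groups -/

section Injectivity

open Matrix

/-- The class of the unit of the `k × k` matrices. -/
def MvNSemigroup.unitClass (R : Type u) [Ring R] [StarRing R] (k : ℕ) : MvNSemigroup R :=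
  Quotient.mk _ ⟨k, 1, .one _⟩

/-- Every element of `V(R)` has a complement to the class of a unit matrix. -/
theorem MvNSemigroup.exists_add_eq_one {R : Type u} [Ring R] [StarRing R] (c : MvNSemigroup R) :
    ∃ (d : MvNSemigroup R) (k : ℕ), c + d = unitClass R k := by
  induction c using Quotient.inductionOn with | _ r
  have h1 : r.mat * r.mat = r.mat := r.isProj.isIdempotentElem
  have h2 : r.matᴴ = r.mat := r.isProj.isSelfAdjoint
  let r' : ProjMat R := ⟨r.size, 1 - r.mat, r.isProj.one_sub⟩
  refine ⟨Quotient.mk _ r', r.size, Quotient.sound ?_⟩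
  have h : MvN (1 : Matrix (Fin r.size) (Fin r.size) R)
      (Matrix.fromBlocks r.mat 0 0 (1 - r.mat)) := by
    -- For the row `v = (r, 1 - r)`, one has `v v⋆ = r + (1 - r) = 1`, while `v⋆ v` is diagonal
    -- because `r (1 - r) = 0`.
    refine ⟨Matrix.fromCols r.mat (1 - r.mat), ?_, ?_⟩
    · rw [conjTranspose_fromCols_eq_fromRows_conjTranspose, fromCols_mul_fromRows]
      simp [h2, h1, mul_sub, sub_mul]
    · rw [conjTranspose_fromCols_eq_fromRows_conjTranspose, fromRows_mul_fromCols]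
      simp [h2, h1, mul_sub, sub_mul]
  exact (h.trans (.one _) (r.add r').isProj (r.mvN_add r')).symm

/-- If `V(f)` is injective, then so is `K₀(f)`. -/
theorem UnitalK0.map_injective {R : Type u} {S : Type v} [CStarAlgebra R] [CStarAlgebra S]
    (f : R →⋆ₐ[ℂ] S) (hf : Function.Injective (MvNSemigroup.map f)) :
    Function.Injective (UnitalK0.map f) := by
  rw [injective_iff_map_eq_zero]
  intro z hz
  -- Every class is a formal difference `[a] - [b]`, so the aim is `[a] = [b]`.
  obtain ⟨⟨a, b, _⟩, hab⟩ := (AddLocalization.addMonoidOf (⊤ : AddSubmonoid (MvNSemigroup R))).surj z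
  have hab' : z + Algebra.GrothendieckAddGroup.of b = Algebra.GrothendieckAddGroup.of a := hab
  have h1 := congrArg (UnitalK0.map f) hab'
  rw [map_add, hz, zero_add, UnitalK0.map_of, UnitalK0.map_of] at h1
  obtain ⟨⟨c, _⟩, hc⟩ :=
    ((AddLocalization.addMonoidOf (⊤ : AddSubmonoid (MvNSemigroup S))).eq_iff_exists).1 h1
  have hc' : c + MvNSemigroup.map f b = c + MvNSemigroup.map f a := hc
  -- The summand `c` need not come from `R`. Adding its complement `d` replaces it by a unit class,
  -- which does, and injectivity on semigroups applies.
  obtain ⟨d, k, hd⟩ := MvNSemigroup.exists_add_eq_one c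
  have hone : MvNSemigroup.map f (MvNSemigroup.unitClass R k) =
      MvNSemigroup.unitClass S k := by
    refine Quotient.sound ?_
    change MvN ((1 : Matrix (Fin k) (Fin k) R).map f) (1 : Matrix (Fin k) (Fin k) S)
    rw [Matrix.map_one f (map_zero f) (map_one f)]
    exact MvN.refl (.one _)
  have h2 : MvNSemigroup.unitClass R k + b = MvNSemigroup.unitClass R k + a := by
    apply hf
    rw [map_add, map_add, hone, ← hd, add_comm c d, add_assoc, hc', add_assoc]
  have h3 : Algebra.GrothendieckAddGroup.of b = Algebra.GrothendieckAddGroup.of a := by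
    have := congrArg (Algebra.GrothendieckAddGroup.of (M := MvNSemigroup R)) h2
    rw [map_add, map_add] at this
    exact add_left_cancel this
  rw [← h3] at hab'
  exact add_eq_right.1 hab'

variable {A : Type u} {B : Type v} [NonUnitalCStarAlgebra A] [NonUnitalCStarAlgebra B]

/-- The constant sequence one acts as a unit on `R_∞`, which makes the extension of `ψ` to the
unitization multiplicative. -/
theorem seqIncl_one_mul {R : Type u} [CStarAlgebra R] (q : SeqAlg R) : seqIncl R 1 * q = q := by
  obtain ⟨a, rfl⟩ := SeqAlg.mk_surjective R q
  rw [seqIncl_apply, ← map_mul]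
  congr 1; ext n
  exact one_mul (a n)

theorem mul_seqIncl_one {R : Type u} [CStarAlgebra R] (q : SeqAlg R) : q * seqIncl R 1 = q := by
  obtain ⟨a, rfl⟩ := SeqAlg.mk_surjective R q
  rw [seqIncl_apply, ← map_mul]
  congr 1; ext n
  exact mul_one (a n)

/-- The extension of a `*`-homomorphism `B → A_∞` to the unitization, with values in `(A~)_∞`. -/
def unitizationSeqHom (ψ : B →⋆ₙₐ[ℂ] SeqAlg A) :
    Unitization ℂ B →⋆ₙₐ[ℂ] SeqAlg (Unitization ℂ A) where
  toFun b := b.fst • seqIncl (Unitization ℂ A) 1 +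
    SeqAlg.map (Unitization.inrNonUnitalStarAlgHom ℂ A) (ψ b.snd)
  map_smul' c b := by simp [smul_smul]
  map_zero' := by simp
  map_add' b c := by
    simp only [Unitization.fst_add, Unitization.snd_add, add_smul, map_add]
    abel
  map_mul' b c := by
    simp only [Unitization.fst_mul, Unitization.snd_mul, map_add, map_mul ψ, map_mul (SeqAlg.map _),
      map_smul, add_mul, mul_add, smul_add, smul_mul_assoc, mul_smul_comm, seqIncl_one_mul,
      mul_seqIncl_one, smul_smul, mul_comm c.fst b.fst]
    abel
  map_star' b := by
    simp [map_star, ← map_star (seqIncl (Unitization ℂ A))]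

/-- The extended `ψ` splits the unitized map, so `MvN.of_map` makes the map on semigroups of
projections injective. `K0` is a subgroup of `UnitalK0` of the unitization, and injectivity
restricts to it. -/
theorem SeqSplit.K0_map_injective {φ : A →⋆ₙₐ[ℂ] B} (hφ : SeqSplit φ) :
    Function.Injective (K0.map φ) := by
  obtain ⟨ψ, hψ⟩ := hφ
  have hg : ∀ r, unitizationSeqHom ψ (Unitization.starMap φ r) =
      seqIncl (Unitization ℂ A) r := by
    intro r
    have h1 : ψ (φ r.snd) = seqIncl A r.snd := DFunLike.congr_fun hψ r.snd
    have h2 : unitizationSeqHom ψ (Unitization.starMap φ r) =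
        r.fst • seqIncl (Unitization ℂ A) 1 +
          SeqAlg.map (Unitization.inrNonUnitalStarAlgHom ℂ A) (ψ (φ r.snd)) := by
      simp [unitizationSeqHom, Unitization.algebraMap_eq_inl]
    rw [h2, h1, SeqAlg.map_seqIncl, ← map_smul, ← map_add]
    congr 1
    ext <;> simp
  have hV : Function.Injective (MvNSemigroup.map (Unitization.starMap φ)) := by
    intro a b hab
    induction a using Quotient.inductionOn with | _ p
    induction b using Quotient.inductionOn with | _ q
    exact Quotient.sound (MvN.of_map _ _ hg p.isProj q.isProj (Quotient.exact hab))
  intro a b hab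
  exact Subtype.ext (UnitalK0.map_injective _ hV (congrArg Subtype.val hab))

end Injectivity

end

theorem theorem2p7 {A : Type u} {B : Type v} [NonUnitalCStarAlgebra A] [NonUnitalCStarAlgebra B]
    (φ : A →⋆ₙₐ[ℂ] B) (hφ : SeqSplit φ) :
    (∀ (E : NonUnitalStarSubalgebra ℂ A) [IsClosed (E : Set A)], IsHereditary E →
      SeqSplit (hereditaryRestrict φ E)) ∧
    (∀ J : ClosedIdeal A, SeqSplit (J.restrict φ) ∧ SeqSplit (J.quotientMap φ)) ∧
    Function.Injective (ClosedIdeal.map φ) ∧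
    (∀ (C : Type w) (D : Type x) [NonUnitalCStarAlgebra C] [NonUnitalCStarAlgebra D]
      (ρ : C →⋆ₙₐ[ℂ] D), SeqSplit ρ → SeqSplit (MaxTensor.map φ ρ)) ∧
    (∀ a b : Cu A, Cu.map φ a ≤ Cu.map φ b ↔ a ≤ b) ∧
    (Function.Injective (K0.map φ) ∧ Function.Injective (K1.map φ) ∧
      ∀ n : ℕ, 2 ≤ n → Function.Injective (K0Mod.map n φ) ∧ Function.Injective (K1Mod.map n φ)) ∧
    (∀ τ : TracialState A, ∃ τ' : TracialState B, ∀ a : A, τ' (φ a) = τ a) := by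
  -- `K1` is `K0` of the suspension. The statement is kept general in the algebras since it is
  -- applied to `φ` and also to `φ ⊗ id` on the tensor products with `mooreAlgebra n`.
  have hK1 : ∀ {A : Type u} {B : Type v} [NonUnitalCStarAlgebra A] [NonUnitalCStarAlgebra B]
      {φ : A →⋆ₙₐ[ℂ] B}, SeqSplit φ → Function.Injective (K1.map φ) := fun hφ =>
    ((SeqSplit.id _).maxTensorMap hφ).K0_map_injective
  refine ⟨fun E _ hE => hφ.hereditaryRestrict E hE, fun J => ⟨hφ.idealRestrict J, hφ.quotientMap J⟩,
    hφ.idealMap_injective, fun C D _ _ ρ hρ => hφ.maxTensorMap hρ, hφ.cuMap_le_iff,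
    ⟨hφ.K0_map_injective, hK1 hφ, fun n _ => ?_⟩, hφ.exists_tracialState⟩
  have hn := hφ.maxTensorMap (SeqSplit.id (mooreAlgebra n))
  exact ⟨hn.K0_map_injective, hK1 hn⟩
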